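/- Identify $\mathbb R^n$ with its dual by the standard inner product; write $K^\circ=\{p:\langle p,q\rangle\le 1\ \forall q\in K\}$ and $\|q\|_T=\max_{p\in T}\langle p,q\rangle$, so that $\|\cdot\|_{K^\circ}$ has unit ball $K$ for a symmetric convex body $K$. Hanner polytopes are the bodies obtained from the segment $[-1,1]\subset\mathbb R^1$ by repeatedly forming, from $K\subset\mathbb R^k$ and $L\subset\mathbb R^l$, the bodies $K\oplus_1L$ and $K\oplus_\infty L$ in $\mathbb R^{k+l}$, which are the unit balls of the sum, respectively the maximum, of the norms with unit balls $K$ and $L$. A point $q\in\partial K$ lies in a smooth piece of $\partial K$ if $\|\cdot\|_{K^\circ}$ is differentiable at $q$ (for a polytope: $q$ is in the relative interior of a facet); then $n_K(q)=d\|q\|_{K^\circ}$ is the outer normal. A classical billiard trajectory in $K\times T$ consists of points $q_i$ in smooth pieces of $\partial K$ and momenta $p_i$ in smooth pieces of $\partial T$ ($i\ge 1$) such that, for all $i$, $$p_{i+1}-p_i=-\lambda_i\,n_K(q_i),\qquad q_{i+1}-q_i=\mu_i\,n_T(p_{i+1}),\qquad \lambda_i,\mu_i>0,$$ and $q\mapsto\|q_{i+2}-q\|_T+\|q-q_i\|_T$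 restricted to $\partial K$ has a local minimum at $q_{i+1}$. It is closed with $m\ge2$ bounces if $(q_{i+m},p_{i+m})=(q_i,p_i)$ for all $i$; its length is then $\sum_{i=1}^m\|q_{i+1}-q_i\|_T$, and it is simple if for no $0<d<m$ one has $q_{i+d}=q_i$ for all $i$ (the route is not passed several times). **Statement.** Let $H\subset\mathbb R^n$ be a Hanner polytope. Consider the initial positions $(q_1,p_1)\in\partial H\times\partial H^\circ$ such that $q_1$ lies in a smooth piece of $\partial H$ and the vector $-n_H(q_1)$, drawn from $p_1$, points into the interior of $H^\circ$ (that is, $p_1-t\,n_H(q_1)\in\operatorname{int}H^\circ$ for all small $t>0$). Almost all of them, with respect to the $(2n-2)$-dimensional surface measure on $\partial H\times\partial H^\circ$, generate a closed simple classical billiard trajectory of length $4$ in $H\times H^\circ$: there is exactly one classical billiard trajectory in $H\times H^\circ$ starting from $(q_1,p_1)$, and it is closed with some number $m\ge 2$ of bounces for which it is simple and has length $4$. -/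

import Mathlib

open MeasureTheory Set

namespace Billiard

noncomputable section

variable {n : ℕ}

/-- The polar body `K° = {p | ⟨p, q⟩ ≤ 1 for all q ∈ K}`, with `ℝⁿ` identified with its dual
through the standard inner product. -/
def polarBody (K : Set (EuclideanSpace ℝ (Fin n))) : Set (EuclideanSpace ℝ (Fin n)) :=
  {p | ∀ q ∈ K, inner ℝ p q ≤ 1}

/-- The (possibly non-symmetric) norm `‖q‖_T = max {⟨p, q⟩ | p ∈ T}`, whose unit ball is `T°`. -/
def bodyNorm (T : Set (EuclideanSpace ℝ (Fin n))) (q : EuclideanSpace ℝ (Fin n)) : ℝ :=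
  sSup ((fun p => inner ℝ p q) '' T)

/-- The point `q` lies in a smooth piece of `∂K`: it is a boundary point at which the norm
`‖·‖_{K°}`, whose unit ball is `K`, is differentiable. For a polytope this says that `q` lies in
the relative interior of a facet. -/
def IsSmoothBoundaryPoint (K : Set (EuclideanSpace ℝ (Fin n)))
    (q : EuclideanSpace ℝ (Fin n)) : Prop :=
  q ∈ frontier K ∧ DifferentiableAt ℝ (bodyNorm (polarBody K)) q

/-- The outer normal `n_K(q) = d‖q‖_{K°}` at a point of a smooth piece of `∂K`. -/
def outerNormal (K : Set (EuclideanSpace ℝ (Fin n))) (q : EuclideanSpace ℝ (Fin n)) :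
    EuclideanSpace ℝ (Fin n) :=
  gradient (bodyNorm (polarBody K)) q

/-- The polygonal line `a → b → c` has a billiard reflection at `b ∈ ∂K`: the length functional
`q ↦ ‖c - q‖_T + ‖q - a‖_T` has at `b` a local minimum under the constraint `q ∈ ∂K`. -/
def HasBilliardReflection (K T : Set (EuclideanSpace ℝ (Fin n)))
    (a b c : EuclideanSpace ℝ (Fin n)) : Prop :=
  a ∈ K ∧ b ∈ frontier K ∧ c ∈ K ∧
    IsLocalMinOn (fun q => bodyNorm T (c - q) + bodyNorm T (q - a)) (frontier K) b

/-- The sequences `q₀, q₁, …` (coordinates) and `p₀, p₁, …` (momenta) form a classical billiard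
trajectory in the configuration `K × T`. Here `p i` is the momentum before, and `p (i + 1)` the
momentum after, the reflection at `q i`; between `q i` and `q (i + 1)` the point moves with the
velocity `n_T(p (i + 1)) = d‖p (i + 1)‖_{T°}`. -/
structure IsClassicalTrajectory (K T : Set (EuclideanSpace ℝ (Fin n)))
    (q p : ℕ → EuclideanSpace ℝ (Fin n)) : Prop where
  smooth_coordinate : ∀ i, IsSmoothBoundaryPoint K (q i)
  smooth_momentum : ∀ i, IsSmoothBoundaryPoint T (p i)
  momentum_change : ∀ i, ∃ c : ℝ, 0 < c ∧ p (i + 1) - p i = -(c • outerNormal K (q i))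
  coordinate_change : ∀ i, ∃ c : ℝ, 0 < c ∧ q (i + 1) - q i = c • outerNormal T (p (i + 1))
  reflection : ∀ i, HasBilliardReflection K T (q i) (q (i + 1)) (q (i + 2))

/-- The trajectory is closed, with `m ≥ 2` bounces `q 0, …, q (m - 1)`. -/
def IsClosedTrajectory (m : ℕ) (q p : ℕ → EuclideanSpace ℝ (Fin n)) : Prop :=
  2 ≤ m ∧ ∀ i, q (i + m) = q i ∧ p (i + m) = p i

/-- The closed polygonal line `q 0 → ⋯ → q (m - 1) → q 0` does not pass the same route several
times: no smaller shift preserves it. -/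
def IsSimpleTrajectory (m : ℕ) (q : ℕ → EuclideanSpace ℝ (Fin n)) : Prop :=
  ∀ d, 0 < d → d < m → ∃ i, q (i + d) ≠ q i

/-- The length of the closed polygonal line `q 0 → ⋯ → q (m - 1) → q m = q 0`, measured with
the norm `‖·‖_T`. -/
def closedLength (T : Set (EuclideanSpace ℝ (Fin n))) (m : ℕ)
    (q : ℕ → EuclideanSpace ℝ (Fin n)) : ℝ :=
  ∑ i ∈ Finset.range m, bodyNorm T (q (i + 1) - q i)

/-- The initial position `(q₀, p₀)` generates the classical trajectory `(q, p)` in `K × T`: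
this trajectory starts at `(q₀, p₀)`, and it is the only one that does. -/
def Generates (K T : Set (EuclideanSpace ℝ (Fin n))) (q₀ p₀ : EuclideanSpace ℝ (Fin n))
    (q p : ℕ → EuclideanSpace ℝ (Fin n)) : Prop :=
  (IsClassicalTrajectory K T q p ∧ q 0 = q₀ ∧ p 0 = p₀) ∧
    ∀ q' p' : ℕ → EuclideanSpace ℝ (Fin n),
      IsClassicalTrajectory K T q' p' → q' 0 = q₀ → p' 0 = p₀ → q' = q ∧ p' = p

/-- The point `q₀` lies in a smooth piece of `∂K`, the point `p₀` lies on `∂T`, and the vector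
`-n_K(q₀)`, drawn from `p₀`, points into the interior of `T`. -/
def IsAdmissiblePosition (K T : Set (EuclideanSpace ℝ (Fin n)))
    (q₀ p₀ : EuclideanSpace ℝ (Fin n)) : Prop :=
  IsSmoothBoundaryPoint K q₀ ∧ p₀ ∈ frontier T ∧
    ∃ ε : ℝ, 0 < ε ∧ ∀ t : ℝ, 0 < t → t < ε → p₀ - t • outerNormal K q₀ ∈ interior T

/-- The first `k` coordinates of a point of `ℝ^(k + l)`. -/
def firstPart {k l : ℕ} (x : EuclideanSpace ℝ (Fin (k + l))) : EuclideanSpace ℝ (Fin k) :=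
  WithLp.toLp 2 fun i => x (Fin.castAdd l i)

/-- The last `l` coordinates of a point of `ℝ^(k + l)`. -/
def lastPart {k l : ℕ} (x : EuclideanSpace ℝ (Fin (k + l))) : EuclideanSpace ℝ (Fin l) :=
  WithLp.toLp 2 fun i => x (Fin.natAdd k i)

/-- `K ⊕₁ L`: the unit ball of the sum of the norms with unit balls `K` and `L`. -/
def oneSum {k l : ℕ} (K : Set (EuclideanSpace ℝ (Fin k))) (L : Set (EuclideanSpace ℝ (Fin l))) :
    Set (EuclideanSpace ℝ (Fin (k + l))) :=
  {x | gauge K (firstPart x) + gauge L (lastPart x) ≤ 1}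

/-- `K ⊕_∞ L`: the unit ball of the maximum of the norms with unit balls `K` and `L`. -/
def infSum {k l : ℕ} (K : Set (EuclideanSpace ℝ (Fin k))) (L : Set (EuclideanSpace ℝ (Fin l))) :
    Set (EuclideanSpace ℝ (Fin (k + l))) :=
  {x | max (gauge K (firstPart x)) (gauge L (lastPart x)) ≤ 1}

/-- Hanner polytopes: the segment `[-1, 1]`, and everything obtained from it by the operations
`⊕₁` and `⊕_∞`. -/
inductive IsHannerPolytope : (n : ℕ) → Set (EuclideanSpace ℝ (Fin n)) → Prop
  | segment : IsHannerPolytope 1 {x | -1 ≤ x 0 ∧ x 0 ≤ 1}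
  | oneSum {k l : ℕ} {K : Set (EuclideanSpace ℝ (Fin k))} {L : Set (EuclideanSpace ℝ (Fin l))} :
      IsHannerPolytope k K → IsHannerPolytope l L → IsHannerPolytope (k + l) (oneSum K L)
  | infSum {k l : ℕ} {K : Set (EuclideanSpace ℝ (Fin k))} {L : Set (EuclideanSpace ℝ (Fin l))} :
      IsHannerPolytope k K → IsHannerPolytope l L → IsHannerPolytope (k + l) (infSum K L)

/-- The surface measure on `∂K × ∂T`, the `(2n - 2)`-dimensional Hausdorff measure. On each
product of two facets of polytopes it is a constant multiple of the product of the
`(n - 1)`-dimensional measures of the facets. -/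
def boundaryMeasure (K T : Set (EuclideanSpace ℝ (Fin n))) :
    Measure (EuclideanSpace ℝ (Fin n) × EuclideanSpace ℝ (Fin n)) :=
  (Measure.hausdorffMeasure (2 * (n : ℝ) - 2)).restrict (frontier K ×ˢ frontier T)

end

end Billiard

/-!
For generic initial positions (those with rationally independent coordinates) all bounces lie in
the interiors of facets, and the trajectory is determined step by step. Measure the time of such an
orbit in `a H × b H°` by the motion of the momentum. An orbit of `H` is called antipodal if after
`n` bounces and time `2 * b` it is at the antipode of its starting point, its coordinate having
covered the length `2 * a`. Then for `a = b = 1` it is closed after `2 * n` bounces, with length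
`2 + 2 = 4`.

Antipodality is proved by induction along the construction of `H`. In `K ⊕₁ L` the momenta of the
two factors move on a common clock, and each bounce is a bounce of exactly one of the factors, so
an orbit of the sum is obtained by merging an orbit of each factor. At the time `2 * b` both of them
are at their antipodes, after `k` and `l` bounces, so the orbit of the sum has bounced `k + l` times
and is at its antipode. The case of `K ⊕_∞ L` follows by exchanging coordinates and momenta.

The nongeneric positions lie in countably many affine subspaces of codimension three, which are
null sets for the surface measure.
-/

namespace Billiard

noncomputable section

open scoped RealInnerProductSpace

/-! ### Polytopes and their norms -/

section Polytope

variable {E : Type*} [NormedAddCommGroup E] [InnerProductSpace ℝ E] {W V : Set E} {q w : E}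

/-- The functional `⟪w, ·⟫` is maximal at `q` among those given by `W`. -/
def IsActive (W : Set E) (q w : E) : Prop :=
  w ∈ W ∧ ∀ w' ∈ W, ⟪w', q⟫ ≤ ⟪w, q⟫

theorem exists_isActive (hW : W.Finite) (hne : W.Nonempty) (q : E) : ∃ w, IsActive W q w :=
  exists_max_image W (fun w => ⟪w, q⟫) hW hne

/-- The polar body of the convex hull of `W`. -/
def vertexPolar (W : Set E) : Set E :=
  {q | ∀ w ∈ W, ⟪w, q⟫ ≤ 1}

theorem gauge_vertexPolar (h : IsActive W q w) (h0 : 0 ≤ ⟪w, q⟫) :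
    gauge (vertexPolar W) q = ⟪w, q⟫ := by
  have smul_mem {r : ℝ} (hr : 0 < r) (hle : ⟪w, q⟫ ≤ r) : r⁻¹ • q ∈ vertexPolar W := by
    intro u hu
    rw [inner_smul_right, inv_mul_le_one₀ hr]
    exact (h.2 u hu).trans hle
  refine le_antisymm (le_of_forall_pos_le_add fun ε hε => ?_) (le_csInf ?_ ?_)
  · have hr : 0 < ⟪w, q⟫ + ε := by linarith
    refine gauge_le_of_mem hr.le ?_
    rw [mem_smul_set_iff_inv_smul_mem₀ hr.ne']
    exact smul_mem hr (by linarith)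
  · refine ⟨⟪w, q⟫ + 1, by linarith, ?_⟩
    rw [mem_smul_set_iff_inv_smul_mem₀ (by linarith)]
    exact smul_mem (by linarith) (by linarith)
  · rintro r ⟨hr, hmem⟩
    rw [mem_smul_set_iff_inv_smul_mem₀ (ne_of_gt hr)] at hmem
    have := hmem w h.1
    rwa [inner_smul_right, inv_mul_le_one₀ hr] at this

theorem isClosed_vertexPolar (W : Set E) : IsClosed (vertexPolar W) := by
  simp only [vertexPolar, ofPred_forall]
  exact isClosed_biInter fun w _ =>
    isClosed_le (continuous_const.inner continuous_id) continuous_const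

theorem inner_lt_one_of_mem_interior (hw : w ∈ W) (hne : w ≠ 0)
    (hq : q ∈ interior (vertexPolar W)) : ⟪w, q⟫ < 1 := by
  have hcont : Continuous fun ε : ℝ => q + ε • w := by fun_prop
  have hnear : ∀ᶠ ε : ℝ in nhds 0, q + ε • w ∈ interior (vertexPolar W) :=
    hcont.continuousAt.eventually (isOpen_interior.mem_nhds (by simpa using hq))
  obtain ⟨ε, hmem, hε⟩ :=
    ((hnear.filter_mono nhdsWithin_le_nhds).and self_mem_nhdsWithin : ∀ᶠ ε : ℝ in
      nhdsWithin 0 (Ioi 0), _ ∧ ε ∈ Ioi (0 : ℝ)).exists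
  have hle := interior_subset hmem w hw
  rw [inner_add_right, inner_smul_right] at hle
  have : 0 < ε * ⟪w, w⟫ := mul_pos hε (real_inner_self_pos.2 hne)
  linarith

theorem mem_frontier_vertexPolar (hW : W.Finite) (h0 : ∀ w ∈ W, w ≠ 0) :
    q ∈ frontier (vertexPolar W) ↔ (∀ w ∈ W, ⟪w, q⟫ ≤ 1) ∧ ∃ w ∈ W, ⟪w, q⟫ = 1 := by
  rw [(isClosed_vertexPolar W).frontier_eq]
  refine ⟨fun ⟨hmem, hnot⟩ => ⟨hmem, ?_⟩, fun ⟨hmem, w, hw, heq⟩ =>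
    ⟨hmem, fun hint => (inner_lt_one_of_mem_interior hw (h0 w hw) hint).ne heq⟩⟩
  by_contra! hne
  refine hnot (mem_interior.2 ⟨⋂ w ∈ W, {x | ⟪w, x⟫ < 1},
    fun x hx w hw => (mem_iInter₂.1 hx w hw).le, hW.isOpen_biInter fun w _ =>
      isOpen_lt (continuous_const.inner continuous_id) continuous_const,
    mem_iInter₂.2 fun w hw => (hmem w hw).lt_of_ne (hne w hw)⟩)

theorem exists_exit (hV : V.Finite) {p w : E} {b : ℝ} (hp : ∀ u ∈ V, ⟪u, p⟫ ≤ b)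
    (hex : ∃ u ∈ V, ⟪u, w⟫ < 0) :
    ∃ t : ℝ, 0 ≤ t ∧ (∀ u ∈ V, ⟪u, p - t • w⟫ ≤ b) ∧
      ∃ v ∈ V, ⟪v, w⟫ < 0 ∧ ⟪v, p - t • w⟫ = b := by
  obtain ⟨v, ⟨hv, hvw⟩, hmin⟩ := exists_min_image {u ∈ V | ⟪u, w⟫ < 0}
    (fun u => (b - ⟪u, p⟫) / -⟪u, w⟫) (hV.subset (sep_subset _ _)) hex
  have ht : 0 ≤ (b - ⟪v, p⟫) / -⟪v, w⟫ := div_nonneg (sub_nonneg.2 (hp v hv)) (by linarith)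
  refine ⟨(b - ⟪v, p⟫) / -⟪v, w⟫, ht, fun u hu => ?_, v, hv, hvw, ?_⟩
  · rw [inner_sub_right, inner_smul_right]
    rcases lt_or_ge ⟪u, w⟫ 0 with hneg | hnonneg
    · have := hmin u ⟨hu, hneg⟩
      rw [le_div_iff₀ (by linarith)] at this
      linarith
    · linarith [mul_nonneg ht hnonneg, hp u hu]
  · rw [inner_sub_right, inner_smul_right]
    field_simp [hvw.ne]
    ring

end Polytope

/-! ### Generic points -/

section Generic

variable {ι : Type*} [Fintype ι]

/-- The lattice of integral points of `ℝ^ι`. -/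
def intLattice (ι : Type*) [Fintype ι] : AddSubgroup (EuclideanSpace ℝ ι) :=
  AddMonoidHom.range
    { toFun := fun z : ι → ℤ => WithLp.toLp 2 fun i => (z i : ℝ)
      map_zero' := by ext; simp
      map_add' := fun _ _ => by ext; simp }

theorem mem_intLattice {x : EuclideanSpace ℝ ι} :
    x ∈ intLattice ι ↔ ∃ z : ι → ℤ, x = WithLp.toLp 2 fun i => (z i : ℝ) :=
  exists_congr fun _ => eq_comm

theorem countable_intLattice : (intLattice ι : Set (EuclideanSpace ℝ ι)).Countable :=
  countable_range _

theorem exists_int_inner {x y : EuclideanSpace ℝ ι} (hx : x ∈ intLattice ι)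
    (hy : y ∈ intLattice ι) : ∃ z : ℤ, ⟪x, y⟫ = z := by
  obtain ⟨a, rfl⟩ := mem_intLattice.1 hx
  obtain ⟨b, rfl⟩ := mem_intLattice.1 hy
  exact ⟨∑ i, b i * a i, by simp [PiLp.inner_apply]⟩

theorem inner_smul_mem_intLattice {x y z : EuclideanSpace ℝ ι} (hx : x ∈ intLattice ι)
    (hy : y ∈ intLattice ι) (hz : z ∈ intLattice ι) : ⟪x, y⟫ • z ∈ intLattice ι := by
  obtain ⟨a, ha⟩ := exists_int_inner hx hy
  rw [ha, Int.cast_smul_eq_zsmul]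
  exact zsmul_mem hz a

/-- The coordinates of `x` are linearly independent over the rationals. -/
def IsGeneric (x : EuclideanSpace ℝ ι) : Prop :=
  ∀ c ∈ intLattice ι, ⟪c, x⟫ = 0 → c = 0

namespace IsGeneric

variable {p v v' w : EuclideanSpace ℝ ι}

theorem neg (hp : IsGeneric p) : IsGeneric (-p) :=
  fun c hc h => hp c hc (by simpa using h)

theorem eq_of_inner_eq (hp : IsGeneric p) (hv : v ∈ intLattice ι) (hw : w ∈ intLattice ι)
    (h : ⟪v, p⟫ = ⟪w, p⟫) : v = w :=
  sub_eq_zero.1 (hp (v - w) (sub_mem hv hw) (by rw [inner_sub_left, h, sub_self]))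

theorem sub_smul (hp : IsGeneric p) (hv : v ∈ intLattice ι) (hv' : v' ∈ intLattice ι)
    (hw : w ∈ intLattice ι) (hvw : ⟪v, w⟫ ≠ 0) (hvw' : ⟪v', w⟫ ≠ 0) {t : ℝ}
    (ht : ⟪v', p - t • w⟫ = ⟪v, p⟫) : IsGeneric (p - t • w) := by
  intro c hc hcp
  rw [inner_sub_right, inner_smul_right] at ht hcp
  -- Eliminating `t` turns a relation for `p - t • w` into a relation for `p`.
  have relation : ⟪v', w⟫ • c - ⟪c, w⟫ • (v' - v) = 0 := by
    refine hp _ (sub_mem (inner_smul_mem_intLattice hv' hw hc)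
      (inner_smul_mem_intLattice hc hw (sub_mem hv' hv))) ?_
    simp only [inner_sub_left, real_inner_smul_left]
    linear_combination ⟪v', w⟫ * hcp - ⟪c, w⟫ * ht
  have hcw : ⟪c, w⟫ = 0 := by
    have hinner := congrArg (fun x => ⟪x, w⟫) relation
    simp only [inner_sub_left, real_inner_smul_left, inner_zero_left] at hinner
    refine (mul_eq_zero.1 (?_ : ⟪c, w⟫ * ⟪v, w⟫ = 0)).resolve_right hvw
    linear_combination hinner
  rw [hcw, zero_smul, sub_zero] at relation
  exact (smul_eq_zero.1 relation).resolve_left hvw'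

end IsGeneric

end Generic

/-! ### Billiard orbits -/

section Orbit

variable {ι : Type*} [Fintype ι] {W V : Set (EuclideanSpace ℝ ι)} {a b : ℝ}

/-- A finite nonempty symmetric set of nonzero integral vectors, which serve as the vertices of a
polytope and as the facet normals of the polar polytope. -/
structure IsVertexSet (W : Set (EuclideanSpace ℝ ι)) : Prop where
  finite : W.Finite
  nonempty : W.Nonempty
  neg_mem : ∀ w ∈ W, -w ∈ W
  integral : ∀ w ∈ W, w ∈ intLattice ι
  ne_zero : ∀ w ∈ W, w ≠ 0

/-- The vector `p` lies on the boundary of the polytope `⟪u, ·⟫ ≤ b`, `u ∈ V`, it is generic, and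
`v` is the normal of its facet. -/
structure IsFacetPoint (V : Set (EuclideanSpace ℝ ι)) (b : ℝ) (p v : EuclideanSpace ℝ ι) :
    Prop where
  generic : IsGeneric p
  active : IsActive V p v
  level : ⟪v, p⟫ = b

theorem IsActive.neg {q w : EuclideanSpace ℝ ι} (hW : IsVertexSet W) (h : IsActive W q w) :
    IsActive W (-q) (-w) :=
  ⟨hW.neg_mem w h.1, fun w' hw' => by simpa using h.2 (-w') (hW.neg_mem w' hw')⟩

theorem IsActive.nonneg {q w : EuclideanSpace ℝ ι} (hW : IsVertexSet W) (h : IsActive W q w) :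
    0 ≤ ⟪w, q⟫ := by
  have := h.2 (-w) (hW.neg_mem w h.1)
  rw [inner_neg_left] at this
  linarith

namespace IsFacetPoint

variable {p v u : EuclideanSpace ℝ ι}

theorem le (h : IsFacetPoint V b p v) (hu : u ∈ V) : ⟪u, p⟫ ≤ b :=
  (h.active.2 u hu).trans_eq h.level

theorem eq_of_inner_eq (hV : IsVertexSet V) (h : IsFacetPoint V b p v) (hu : u ∈ V)
    (hub : ⟪u, p⟫ = b) : u = v :=
  h.generic.eq_of_inner_eq (hV.integral u hu) (hV.integral v h.active.1) (hub.trans h.level.symm)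

theorem eq_of_isActive (hV : IsVertexSet V) (h : IsFacetPoint V b p v) (hu : IsActive V p u) :
    u = v :=
  h.eq_of_inner_eq hV hu.1 (le_antisymm (h.le hu.1) (h.level ▸ hu.2 v h.active.1))

theorem unique {b' : ℝ} (hV : IsVertexSet V) (h : IsFacetPoint V b p u)
    (h' : IsFacetPoint V b' p v) : u = v ∧ b = b' := by
  obtain rfl := h'.eq_of_isActive hV h.active
  exact ⟨rfl, h.level.symm.trans h'.level⟩

theorem pos (hV : IsVertexSet V) (h : IsFacetPoint V b p v) : 0 < b := by
  rw [← h.level]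
  exact (h.active.nonneg hV).lt_of_ne fun h0 =>
    hV.ne_zero v h.active.1 (h.generic v (hV.integral v h.active.1) h0.symm)

theorem neg (hV : IsVertexSet V) (h : IsFacetPoint V b p v) : IsFacetPoint V b (-p) (-v) :=
  ⟨h.generic.neg, h.active.neg hV, by rw [inner_neg_neg, h.level]⟩

end IsFacetPoint

/-- In time `t` the point `p`, moving with velocity `-w`, crosses the polytope `⟪u, ·⟫ ≤ b`,
`u ∈ V`, from the facet with normal `v` to the point `p'` of the facet with normal `v'`. -/
structure IsFlight (V : Set (EuclideanSpace ℝ ι)) (b : ℝ) (w : EuclideanSpace ℝ ι) (t : ℝ)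
    (p v p' v' : EuclideanSpace ℝ ι) : Prop where
  start : IsFacetPoint V b p v
  finish : IsFacetPoint V b p' v'
  time_pos : 0 < t
  eq : p' = p - t • w
  enters : 0 < ⟪v, w⟫
  leaves : ⟪v', w⟫ < 0

theorem exists_isFlight (hV : IsVertexSet V) {p v w : EuclideanSpace ℝ ι}
    (h : IsFacetPoint V b p v) (hw : w ∈ intLattice ι) (hvw : 0 < ⟪v, w⟫) :
    ∃ t p' v', IsFlight V b w t p v p' v' := by
  obtain ⟨t, ht, hle, v', hv', hvw', hlevel⟩ := exists_exit hV.finite (fun u hu => h.le hu)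
    ⟨-v, hV.neg_mem v h.active.1, by rw [inner_neg_left]; linarith⟩
  have time_ne : 0 ≠ t := by
    rintro rfl
    rw [zero_smul, sub_zero] at hlevel
    rw [h.eq_of_inner_eq hV hv' hlevel] at hvw'
    linarith
  exact ⟨t, p - t • w, v', h,
    ⟨h.generic.sub_smul (hV.integral v h.active.1) (hV.integral v' hv') hw hvw.ne' hvw'.ne
        (hlevel.trans h.level.symm),
      ⟨hv', fun u hu => (hle u hu).trans_eq hlevel.symm⟩, hlevel⟩,
    ht.lt_of_ne time_ne, rfl, hvw, hvw'⟩

namespace IsFlight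

variable {w p v p' v' u : EuclideanSpace ℝ ι} {s t : ℝ}

theorem neg (hV : IsVertexSet V) (h : IsFlight V b w t p v p' v') :
    IsFlight V b (-w) t (-p) (-v) (-p') (-v') where
  start := h.start.neg hV
  finish := h.finish.neg hV
  time_pos := h.time_pos
  eq := by rw [h.eq, smul_neg]; abel
  enters := by rw [inner_neg_neg]; exact h.enters
  leaves := by rw [inner_neg_neg]; exact h.leaves

theorem le_time (h : IsFlight V b w t p v p' v') (hle : ∀ u ∈ V, ⟪u, p - s • w⟫ ≤ b) : s ≤ t := by
  have hs := hle v' h.finish.active.1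
  have ht := h.finish.level
  rw [h.eq] at ht
  rw [inner_sub_right, inner_smul_right] at hs ht
  nlinarith [h.leaves]

theorem time_unique (hV : IsVertexSet V) (h : IsFlight V b w t p v p' v') (hs : 0 < s)
    (hle : ∀ u ∈ V, ⟪u, p - s • w⟫ ≤ b) (hu : u ∈ V) (hub : ⟪u, p - s • w⟫ = b) : s = t := by
  have hut := h.finish.le hu
  have hup := h.start.le hu
  rw [h.eq] at hut
  rw [inner_sub_right, inner_smul_right] at hub hut
  have nonpos : ⟪u, w⟫ ≤ 0 := by nlinarith
  have neg : ⟪u, w⟫ < 0 := nonpos.lt_of_ne fun h0 => by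
    rw [h0, mul_zero, sub_zero] at hub
    rw [h.start.eq_of_inner_eq hV hu hub] at h0
    exact h.enters.ne' h0
  exact (h.le_time hle).antisymm (by nlinarith)

end IsFlight

/-- A billiard orbit through generic points, in the product of the polytopes `⟪w, ·⟫ ≤ a`, `w ∈ W`,
and `⟪v, ·⟫ ≤ b`, `v ∈ V`: `w i` and `v i` are the normals at `q i` and `p i`, and the momentum
moves from `p i` to `p (i + 1)` before the coordinate moves from `q i` to `q (i + 1)`. -/
structure Orbit (W V : Set (EuclideanSpace ℝ ι)) (a b : ℝ) where
  (q p w v : ℕ → EuclideanSpace ℝ ι)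
  (lam mu : ℕ → ℝ)
  momentum : ∀ i, IsFlight V b (w i) (lam i) (p i) (v i) (p (i + 1)) (v (i + 1))
  coordinate : ∀ i, IsFlight W a (-v (i + 1)) (mu i) (q i) (w i) (q (i + 1)) (w (i + 1))

/-- An initial position of an orbit, before the reflection at `q`. -/
structure Position (W V : Set (EuclideanSpace ℝ ι)) (a b : ℝ) where
  (q p w v : EuclideanSpace ℝ ι)
  coordinate : IsFacetPoint W a q w
  momentum : IsFacetPoint V b p v
  inward : 0 < ⟪v, w⟫

theorem Position.exists_next (hW : IsVertexSet W) (hV : IsVertexSet V) (s : Position W V a b) :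
    ∃ (s' : Position W V a b) (x y : ℝ), IsFlight V b s.w x s.p s.v s'.p s'.v ∧
      IsFlight W a (-s'.v) y s.q s.w s'.q s'.w := by
  obtain ⟨x, p', v', hp⟩ := exists_isFlight hV s.momentum
    (hW.integral _ s.coordinate.active.1) s.inward
  obtain ⟨y, q', w', hq⟩ := exists_isFlight hW s.coordinate
    (neg_mem (hV.integral _ hp.finish.active.1))
    (by rw [inner_neg_right, real_inner_comm]; linarith [hp.leaves])
  have inward : 0 < ⟪v', w'⟫ := by
    have := hq.leaves
    rw [inner_neg_right, real_inner_comm] at this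
    linarith
  exact ⟨⟨q', p', w', v', hq.finish, hp.finish, inward⟩, x, y, hp, hq⟩

theorem exists_orbit (hW : IsVertexSet W) (hV : IsVertexSet V) {q₀ p₀ w₀ v₀ : EuclideanSpace ℝ ι}
    (hq : IsFacetPoint W a q₀ w₀) (hp : IsFacetPoint V b p₀ v₀) (hvw : 0 < ⟪v₀, w₀⟫) :
    ∃ o : Orbit W V a b, o.q 0 = q₀ ∧ o.p 0 = p₀ := by
  choose next x y hmomentum hcoordinate using Position.exists_next (a := a) (b := b) hW hV
  let s : ℕ → Position W V a b := fun i => next^[i] ⟨q₀, p₀, w₀, v₀, hq, hp, hvw⟩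
  have s_succ (i : ℕ) : s (i + 1) = next (s i) := Function.iterate_succ_apply' next i _
  exact ⟨{ q := fun i => (s i).q
           p := fun i => (s i).p
           w := fun i => (s i).w
           v := fun i => (s i).v
           lam := fun i => x (s i)
           mu := fun i => y (s i)
           momentum := fun i => by simpa only [s_succ] using hmomentum (s i)
           coordinate := fun i => by simpa only [s_succ] using hcoordinate (s i) }, rfl, rfl⟩

namespace Orbit

theorem facet_p (o : Orbit W V a b) (i : ℕ) : IsFacetPoint V b (o.p i) (o.v i) :=
  (o.momentum i).start

theorem facet_q (o : Orbit W V a b) (i : ℕ) : IsFacetPoint W a (o.q i) (o.w i) :=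
  (o.coordinate i).start

theorem p_succ (o : Orbit W V a b) (i : ℕ) : o.p (i + 1) = o.p i - o.lam i • o.w i :=
  (o.momentum i).eq

theorem q_succ (o : Orbit W V a b) (i : ℕ) : o.q (i + 1) = o.q i + o.mu i • o.v (i + 1) := by
  rw [(o.coordinate i).eq, smul_neg, sub_neg_eq_add]

/-- The orbit starting with the `j`-th reflection. -/
def shift (o : Orbit W V a b) (j : ℕ) : Orbit W V a b where
  q i := o.q (i + j)
  p i := o.p (i + j)
  w i := o.w (i + j)
  v i := o.v (i + j)
  lam i := o.lam (i + j)
  mu i := o.mu (i + j)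
  momentum i := by simpa only [add_right_comm i 1 j] using o.momentum (i + j)
  coordinate i := by simpa only [add_right_comm i 1 j] using o.coordinate (i + j)

/-- The orbit obtained by exchanging the roles of coordinates and momenta. -/
def flip (hW : IsVertexSet W) (o : Orbit W V a b) : Orbit V W b a where
  q i := o.p (i + 1)
  p i := -o.q i
  w i := o.v (i + 1)
  v i := -o.w i
  lam := o.mu
  mu i := o.lam (i + 1)
  momentum i := by simpa only [neg_neg] using (o.coordinate i).neg hW
  coordinate i := by simpa only [neg_neg] using o.momentum (i + 1)

theorem inner_p_sub (o : Orbit W V a b) (i : ℕ) :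
    ⟪o.p (i + 1), o.q (i + 1) - o.q i⟫ = b * o.mu i := by
  rw [o.q_succ, add_sub_cancel_left, inner_smul_right, real_inner_comm, (o.facet_p _).level,
    mul_comm]

theorem inner_sub_q (o : Orbit W V a b) (i : ℕ) :
    ⟪o.p i - o.p (i + 1), o.q i⟫ = a * o.lam i := by
  rw [o.p_succ, sub_sub_cancel, real_inner_smul_left, (o.facet_q _).level, mul_comm]

theorem sum_action (o : Orbit W V a b) (m : ℕ) :
    b * ∑ i ∈ Finset.range m, o.mu i =
      a * ∑ i ∈ Finset.range m, o.lam i + (⟪o.p m, o.q m⟫ - ⟪o.p 0, o.q 0⟫) := by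
  rw [← Finset.sum_range_sub (fun i => ⟪o.p i, o.q i⟫), Finset.mul_sum, Finset.mul_sum,
    ← Finset.sum_add_distrib]
  refine Finset.sum_congr rfl fun i _ => ?_
  rw [← o.inner_p_sub, ← o.inner_sub_q, inner_sub_left, inner_sub_right]
  ring

theorem w_eq_neg (hW : IsVertexSet W) (o : Orbit W V a b) {m : ℕ} (hq : o.q m = -o.q 0) :
    o.w m = -o.w 0 :=
  ((o.facet_q m).eq_of_isActive hW (hq ▸ (o.facet_q 0).active.neg hW)).symm

theorem eq_zero_of_antipodal (hW : IsVertexSet W) (hV : IsVertexSet V) (o : Orbit W V a b) {m : ℕ}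
    {t : ℝ} (hq : o.q m = -o.q 0) (hp : o.p m = -(o.p 0 + t • o.w 0)) : t = 0 := by
  have level_m := (o.facet_p m).level
  have level_0 := (o.facet_p 0).level
  have le_m := (o.facet_p m).le (hV.neg_mem _ (o.facet_p 0).active.1)
  have le_0 := (o.facet_p 0).le (hV.neg_mem _ (o.facet_p m).active.1)
  have enters_m := (o.momentum m).enters
  have enters_0 := (o.momentum 0).enters
  rw [o.w_eq_neg hW hq] at enters_m
  rw [hp] at le_m level_m
  simp only [inner_neg_left, inner_neg_right, inner_add_right, inner_smul_right] at *
  exact le_antisymm (by nlinarith) (by nlinarith)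

/-- After `m` reflections the orbit is at the antipode of its starting point, having run half of
its length. -/
structure IsAntipodalAt (o : Orbit W V a b) (m : ℕ) : Prop where
  q_eq : o.q m = -o.q 0
  p_eq : o.p m = -o.p 0
  sum_lam : ∑ i ∈ Finset.range m, o.lam i = 2 * b
  sum_mu : ∑ i ∈ Finset.range m, o.mu i = 2 * a

theorem mul_sum_mu_of_antipodal (o : Orbit W V a b) {m : ℕ} (hq : o.q m = -o.q 0)
    (hp : o.p m = -o.p 0) :
    b * ∑ i ∈ Finset.range m, o.mu i = a * ∑ i ∈ Finset.range m, o.lam i := by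
  rw [o.sum_action, hq, hp, inner_neg_neg, sub_self, add_zero]

end Orbit

/-- Every orbit reaches the antipode of its starting point after `m` reflections. -/
def HasAntipodalOrbits (m : ℕ) (W V : Set (EuclideanSpace ℝ ι)) : Prop :=
  ∀ a b (o : Orbit W V a b), o.IsAntipodalAt m

theorem HasAntipodalOrbits.symm {m : ℕ} (hW : IsVertexSet W) (hV : IsVertexSet V)
    (h : HasAntipodalOrbits m V W) : HasAntipodalOrbits m W V := by
  intro a b o
  have flipped := h b a (o.flip hW)
  have sum_mu : ∑ i ∈ Finset.range m, o.mu i = 2 * a := flipped.sum_lam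
  have hp' : o.p (m + 1) = -o.p 1 := flipped.q_eq
  have hq : o.q m = -o.q 0 := neg_injective flipped.p_eq
  have hp : o.p m = -(o.p 0 + (o.lam m - o.lam 0) • o.w 0) := by
    rw [o.p_succ, o.w_eq_neg hW hq, o.p_succ 0] at hp'
    linear_combination (norm := module) hp'
  rw [o.eq_zero_of_antipodal hW hV hq hp, zero_smul, add_zero] at hp
  have action := o.mul_sum_mu_of_antipodal hq hp
  rw [sum_mu] at action
  refine ⟨hq, hp, mul_left_cancel₀ ((o.facet_q 0).pos hW).ne' ?_, sum_mu⟩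
  rw [← action]
  ring

end Orbit

/-! ### Points and polytopes in a product -/

section Glue

variable {k l : ℕ}

/-- The point of `ℝ^(k + l)` with first part `x` and last part `y`. -/
def glue (x : EuclideanSpace ℝ (Fin k)) (y : EuclideanSpace ℝ (Fin l)) :
    EuclideanSpace ℝ (Fin (k + l)) :=
  EuclideanSpace.finAddEquivProd.symm (x, y)

variable (x x' : EuclideanSpace ℝ (Fin k)) (y y' : EuclideanSpace ℝ (Fin l))

theorem glue_castAdd (i : Fin k) : glue x y (Fin.castAdd l i) = x i := by
  simp [glue]

theorem glue_natAdd (i : Fin l) : glue x y (Fin.natAdd k i) = y i := by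
  simp [glue]

@[simp] theorem firstPart_glue : firstPart (glue x y) = x := by
  ext i
  exact glue_castAdd x y i

@[simp] theorem lastPart_glue : lastPart (glue x y) = y := by
  ext i
  exact glue_natAdd x y i

@[simp] theorem glue_parts (z : EuclideanSpace ℝ (Fin (k + l))) :
    glue (firstPart z) (lastPart z) = z := by
  ext i
  exact Fin.addCases (fun i => glue_castAdd _ _ i) (fun i => glue_natAdd _ _ i) i

theorem exists_eq_glue (z : EuclideanSpace ℝ (Fin (k + l))) : ∃ x y, z = glue x y :=
  ⟨firstPart z, lastPart z, (glue_parts z).symm⟩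

variable {x x' y y'} in
theorem glue_inj : glue x y = glue x' y' ↔ x = x' ∧ y = y' := by
  simp [glue]

@[simp] theorem glue_zero :
    glue (0 : EuclideanSpace ℝ (Fin k)) (0 : EuclideanSpace ℝ (Fin l)) = 0 :=
  map_zero EuclideanSpace.finAddEquivProd.symm

theorem glue_add : glue (x + x') (y + y') = glue x y + glue x' y' :=
  map_add EuclideanSpace.finAddEquivProd.symm (x, y) (x', y')

theorem glue_sub : glue (x - x') (y - y') = glue x y - glue x' y' :=
  map_sub EuclideanSpace.finAddEquivProd.symm (x, y) (x', y')

theorem glue_neg : glue (-x) (-y) = -glue x y :=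
  map_neg EuclideanSpace.finAddEquivProd.symm (x, y)

theorem glue_smul (c : ℝ) : glue (c • x) (c • y) = c • glue x y :=
  map_smul EuclideanSpace.finAddEquivProd.symm c (x, y)

theorem inner_glue_left (z : EuclideanSpace ℝ (Fin (k + l))) :
    ⟪glue x y, z⟫ = ⟪x, firstPart z⟫ + ⟪y, lastPart z⟫ := by
  simp only [PiLp.inner_apply, Fin.sum_univ_add, glue_castAdd, glue_natAdd, firstPart, lastPart]

theorem inner_glue : ⟪glue x y, glue x' y'⟫ = ⟪x, x'⟫ + ⟪y, y'⟫ := by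
  rw [inner_glue_left, firstPart_glue, lastPart_glue]

variable {x y}

theorem glue_mem_intLattice (hx : x ∈ intLattice (Fin k)) (hy : y ∈ intLattice (Fin l)) :
    glue x y ∈ intLattice (Fin (k + l)) := by
  obtain ⟨a, rfl⟩ := mem_intLattice.1 hx
  obtain ⟨b, rfl⟩ := mem_intLattice.1 hy
  refine mem_intLattice.2 ⟨Fin.append a b, ?_⟩
  ext i
  refine Fin.addCases (fun i => ?_) (fun i => ?_) i
  · simp [glue_castAdd]
  · simp [glue_natAdd]

theorem IsGeneric.of_glue_left (h : IsGeneric (glue x y)) : IsGeneric x := fun c hc h0 =>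
  (glue_inj.1 ((h (glue c 0) (glue_mem_intLattice hc (zero_mem _))
    (by rw [inner_glue, h0, inner_zero_left, add_zero])).trans glue_zero.symm)).1

theorem IsGeneric.of_glue_right (h : IsGeneric (glue x y)) : IsGeneric y := fun c hc h0 =>
  (glue_inj.1 ((h (glue 0 c) (glue_mem_intLattice (zero_mem _) hc)
    (by rw [inner_glue, h0, inner_zero_left, add_zero])).trans glue_zero.symm)).2

/-- The vertices of the product of two polytopes. -/
def prodVertices (W₁ : Set (EuclideanSpace ℝ (Fin k))) (W₂ : Set (EuclideanSpace ℝ (Fin l))) :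
    Set (EuclideanSpace ℝ (Fin (k + l))) :=
  image2 glue W₁ W₂

/-- The vertices of the free sum of two polytopes. -/
def sumVertices (V₁ : Set (EuclideanSpace ℝ (Fin k))) (V₂ : Set (EuclideanSpace ℝ (Fin l))) :
    Set (EuclideanSpace ℝ (Fin (k + l))) :=
  (glue · 0) '' V₁ ∪ (glue 0 ·) '' V₂

variable {W V : Set (EuclideanSpace ℝ (Fin k))} {W' V' : Set (EuclideanSpace ℝ (Fin l))}

theorem forall_mem_prodVertices {P : EuclideanSpace ℝ (Fin (k + l)) → Prop} :
    (∀ w ∈ prodVertices W W', P w) ↔ ∀ w ∈ W, ∀ w' ∈ W', P (glue w w') :=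
  forall_mem_image2

theorem forall_mem_sumVertices {P : EuclideanSpace ℝ (Fin (k + l)) → Prop} :
    (∀ v ∈ sumVertices V V', P v) ↔ (∀ v ∈ V, P (glue v 0)) ∧ ∀ v ∈ V', P (glue 0 v) := by
  simp only [sumVertices, mem_union, or_imp, forall_and, forall_mem_image]

theorem forall_mem_sumVertices_inner_le {p : EuclideanSpace ℝ (Fin (k + l))} {b : ℝ} :
    (∀ v ∈ sumVertices V V', ⟪v, p⟫ ≤ b) ↔
      (∀ v ∈ V, ⟪v, firstPart p⟫ ≤ b) ∧ ∀ v ∈ V', ⟪v, lastPart p⟫ ≤ b := by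
  simp only [forall_mem_sumVertices, inner_glue_left, inner_zero_left, add_zero, zero_add]

theorem IsVertexSet.prod (hW : IsVertexSet W) (hW' : IsVertexSet W') :
    IsVertexSet (prodVertices W W') where
  finite := hW.finite.image2 _ hW'.finite
  nonempty := hW.nonempty.image2 hW'.nonempty
  neg_mem := forall_mem_prodVertices.2 fun w hw w' hw' =>
    ⟨-w, hW.neg_mem w hw, -w', hW'.neg_mem w' hw', glue_neg w w'⟩
  integral := forall_mem_prodVertices.2 fun w hw w' hw' =>
    glue_mem_intLattice (hW.integral w hw) (hW'.integral w' hw')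
  ne_zero := forall_mem_prodVertices.2 fun w hw _ _ h =>
    hW.ne_zero w hw (glue_inj.1 (h.trans glue_zero.symm)).1

theorem IsVertexSet.sum (hV : IsVertexSet V) (hV' : IsVertexSet V') :
    IsVertexSet (sumVertices V V') where
  finite := (hV.finite.image _).union (hV'.finite.image _)
  nonempty := (hV.nonempty.image _).mono subset_union_left
  neg_mem := forall_mem_sumVertices.2
    ⟨fun v hv => Or.inl ⟨-v, hV.neg_mem v hv, by simp [← glue_neg]⟩,
      fun v hv => Or.inr ⟨-v, hV'.neg_mem v hv, by simp [← glue_neg]⟩⟩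
  integral := forall_mem_sumVertices.2
    ⟨fun v hv => glue_mem_intLattice (hV.integral v hv) (zero_mem _),
      fun v hv => glue_mem_intLattice (zero_mem _) (hV'.integral v hv)⟩
  ne_zero := forall_mem_sumVertices.2
    ⟨fun v hv h => hV.ne_zero v hv (glue_inj.1 (h.trans glue_zero.symm)).1,
      fun v hv h => hV'.ne_zero v hv (glue_inj.1 (h.trans glue_zero.symm)).2⟩

theorem isActive_prodVertices {q w : EuclideanSpace ℝ (Fin k)} {q' w' : EuclideanSpace ℝ (Fin l)} :
    IsActive (prodVertices W W') (glue q q') (glue w w') ↔ IsActive W q w ∧ IsActive W' q' w' := by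
  simp only [IsActive, forall_mem_prodVertices, inner_glue]
  constructor
  · rintro ⟨⟨u, hu, u', hu', heq⟩, hmax⟩
    obtain ⟨rfl, rfl⟩ := glue_inj.1 heq
    exact ⟨⟨hu, fun z hz => by simpa using hmax z hz u' hu'⟩,
      ⟨hu', fun z hz => by simpa using hmax u hu z hz⟩⟩
  · rintro ⟨hmax, hmax'⟩
    exact ⟨mem_image2_of_mem hmax.1 hmax'.1,
      fun z hz z' hz' => add_le_add (hmax.2 z hz) (hmax'.2 z' hz')⟩

end Glue

/-! ### Merging orbits of the factors -/

section PolarPair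

variable {ι : Type*} [Fintype ι] {W V : Set (EuclideanSpace ℝ ι)} {a b : ℝ}

/-- `W` and `V` are the vertex sets of two polytopes that are polar to each other. The condition
`inner_le_mul` is the inclusion of `vertexPolar V` in the polar body of `vertexPolar W`, in
homogeneous form. -/
structure IsPolarPair (W V : Set (EuclideanSpace ℝ ι)) : Prop where
  left : IsVertexSet W
  right : IsVertexSet V
  inner_le_one : ∀ w ∈ W, ∀ v ∈ V, ⟪w, v⟫ ≤ 1
  inner_le_mul : ∀ q p a b, (∀ w ∈ W, ⟪w, q⟫ ≤ a) → (∀ v ∈ V, ⟪v, p⟫ ≤ b) → ⟪p, q⟫ ≤ a * b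

namespace IsPolarPair

theorem symm (h : IsPolarPair W V) : IsPolarPair V W where
  left := h.right
  right := h.left
  inner_le_one v hv w hw := real_inner_comm v w ▸ h.inner_le_one w hw v hv
  inner_le_mul q p a b hq hp := by
    rw [real_inner_comm, mul_comm]
    exact h.inner_le_mul p q b a hp hq

theorem exists_inner_neg (h : IsPolarPair W V) {x : EuclideanSpace ℝ ι} (hx : x ≠ 0) :
    ∃ u ∈ V, ⟪u, x⟫ < 0 := by
  by_contra! hnonneg
  obtain ⟨w, hw⟩ := exists_isActive h.left.finite h.left.nonempty x
  have hle := h.inner_le_mul x x ⟪w, x⟫ 0 hw.2 fun u hu => by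
    have := hnonneg (-u) (h.right.neg_mem u hu)
    rw [inner_neg_left] at this
    linarith
  rw [mul_zero] at hle
  exact hx (real_inner_self_nonpos.1 hle)

theorem oneSum {k l : ℕ} {W V : Set (EuclideanSpace ℝ (Fin k))}
    {W' V' : Set (EuclideanSpace ℝ (Fin l))} (h : IsPolarPair W V) (h' : IsPolarPair W' V') :
    IsPolarPair (prodVertices W W') (sumVertices V V') where
  left := h.left.prod h'.left
  right := h.right.sum h'.right
  inner_le_one := forall_mem_prodVertices.2 fun w hw w' hw' => forall_mem_sumVertices.2
    ⟨fun v hv => by simpa [inner_glue] using h.inner_le_one w hw v hv,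
      fun v hv => by simpa [inner_glue] using h'.inner_le_one w' hw' v hv⟩
  inner_le_mul q p a b hq hp := by
    rw [forall_mem_sumVertices_inner_le] at hp
    obtain ⟨w, hw⟩ := exists_isActive h.left.finite h.left.nonempty (firstPart q)
    obtain ⟨w', hw'⟩ := exists_isActive h'.left.finite h'.left.nonempty (lastPart q)
    obtain ⟨v, hv⟩ := exists_isActive h.right.finite h.right.nonempty (firstPart p)
    have hb : 0 ≤ b := (hv.nonneg h.right).trans (hp.1 v hv.1)
    have hwa : ⟪w, firstPart q⟫ + ⟪w', lastPart q⟫ ≤ a :=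
      inner_glue_left w w' q ▸ hq _ (mem_image2_of_mem hw.1 hw'.1)
    calc ⟪p, q⟫ = ⟪firstPart p, firstPart q⟫ + ⟪lastPart p, lastPart q⟫ := by
          rw [← inner_glue_left, glue_parts]
      _ ≤ ⟪w, firstPart q⟫ * b + ⟪w', lastPart q⟫ * b :=
          add_le_add (h.inner_le_mul _ _ _ _ hw.2 hp.1) (h'.inner_le_mul _ _ _ _ hw'.2 hp.2)
      _ = (⟪w, firstPart q⟫ + ⟪w', lastPart q⟫) * b := (add_mul _ _ _).symm
      _ ≤ a * b := mul_le_mul_of_nonneg_right hwa hb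

end IsPolarPair

end PolarPair

section Clock

variable {ι : Type*} [Fintype ι] {W V : Set (EuclideanSpace ℝ ι)} {a b : ℝ}

namespace Orbit

/-- The time, measured by the motion of the momentum, at which the coordinate arrives at `q c`. -/
def bounceTime (o : Orbit W V a b) (c : ℕ) : ℝ :=
  ∑ i ∈ Finset.range c, o.lam i

/-- The momentum at time `t`, if this time lies between the bounces `c` and `c + 1`. -/
def momentumAt (o : Orbit W V a b) (c : ℕ) (t : ℝ) : EuclideanSpace ℝ ι :=
  o.p c - (t - o.bounceTime c) • o.w c

/-- The time `t` lies between the bounces `c` and `c + 1`. -/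
def InFlight (o : Orbit W V a b) (c : ℕ) (t : ℝ) : Prop :=
  o.bounceTime c ≤ t ∧ t < o.bounceTime (c + 1)

variable {s t : ℝ} {c m : ℕ} {u : EuclideanSpace ℝ ι}

@[simp] theorem bounceTime_zero (o : Orbit W V a b) : o.bounceTime 0 = 0 :=
  Finset.sum_range_zero _

theorem bounceTime_succ (o : Orbit W V a b) (c : ℕ) :
    o.bounceTime (c + 1) = o.bounceTime c + o.lam c :=
  Finset.sum_range_succ _ _

theorem strictMono_bounceTime (o : Orbit W V a b) : StrictMono o.bounceTime :=
  strictMono_nat_of_lt_succ fun c => by linarith [o.bounceTime_succ c, (o.momentum c).time_pos]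

theorem momentumAt_bounceTime (o : Orbit W V a b) (c : ℕ) :
    o.momentumAt c (o.bounceTime c) = o.p c := by
  rw [momentumAt, sub_self, zero_smul, sub_zero]

theorem momentumAt_bounceTime_succ (o : Orbit W V a b) (c : ℕ) :
    o.momentumAt c (o.bounceTime (c + 1)) = o.p (c + 1) := by
  rw [momentumAt, bounceTime_succ, add_sub_cancel_left, p_succ]

theorem momentumAt_add (o : Orbit W V a b) (c : ℕ) (t s : ℝ) :
    o.momentumAt c (t + s) = o.momentumAt c t - s • o.w c := by
  simp only [momentumAt]
  module

theorem inFlight_bounceTime (o : Orbit W V a b) (c : ℕ) : o.InFlight c (o.bounceTime c) :=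
  ⟨le_rfl, o.strictMono_bounceTime c.lt_succ_self⟩

theorem eq_bounceTime_of_isFacetPoint (hV : IsVertexSet V) (o : Orbit W V a b)
    (h : o.InFlight c s) (hst : s < t) (hp : IsFacetPoint V b (o.momentumAt c t) u) :
    t = o.bounceTime (c + 1) ∧ u = o.v (c + 1) := by
  have htime : t - o.bounceTime c = o.lam c :=
    (o.momentum c).time_unique hV (by linarith [h.1]) (fun _ hu => hp.le hu) hp.active.1 hp.level
  have ht : t = o.bounceTime (c + 1) := by rw [bounceTime_succ, ← htime]; ring
  refine ⟨ht, (o.facet_p (c + 1)).eq_of_isActive hV ?_⟩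
  rw [← momentumAt_bounceTime_succ, ← ht]
  exact hp.active

theorem InFlight.of_inner_lt {o : Orbit W V a b} (h : o.InFlight c s) (hst : s ≤ t)
    (hlt : ∀ u ∈ V, ⟪u, o.momentumAt c t⟫ < b) : o.InFlight c t := by
  refine ⟨h.1.trans hst, lt_of_le_of_ne ?_ ?_⟩
  · have : t - o.bounceTime c ≤ o.lam c := (o.momentum c).le_time fun u hu => (hlt u hu).le
    linarith [o.bounceTime_succ c]
  · rintro rfl
    have := hlt _ (o.facet_p (c + 1)).active.1
    rw [momentumAt_bounceTime_succ, (o.facet_p (c + 1)).level] at this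
    exact this.false

theorem q_succ_of_isFacetPoint (hW : IsVertexSet W) (o : Orbit W V a b) (hs : 0 < s)
    (hq : IsFacetPoint W a (o.q c + s • o.v (c + 1)) u) :
    o.q c + s • o.v (c + 1) = o.q (c + 1) := by
  have hq' := hq
  rw [← sub_neg_eq_add, ← smul_neg] at hq'
  rw [(o.coordinate c).time_unique hW hs (fun _ hu => hq'.le hu) hq'.active.1 hq'.level, o.q_succ]

theorem IsAntipodalAt.momentumAt_add (hW : IsVertexSet W) {o : Orbit W V a b}
    (h : o.IsAntipodalAt m) (t s : ℝ) :
    o.momentumAt m (t + s) = -(o.momentumAt 0 t + (2 * b - s) • o.w 0) := by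
  have htime : o.bounceTime m = 2 * b := h.sum_lam
  rw [momentumAt, momentumAt, htime, bounceTime_zero, h.p_eq, o.w_eq_neg hW h.q_eq]
  module

end Orbit

namespace HasAntipodalOrbits

variable {m c : ℕ} {s t : ℝ}

theorem bounceTime_add (h : HasAntipodalOrbits m W V) (o : Orbit W V a b) (c : ℕ) :
    o.bounceTime (c + m) = o.bounceTime c + 2 * b := by
  rw [Orbit.bounceTime, Finset.sum_range_add, ← (h a b (o.shift c)).sum_lam]
  simp only [Orbit.bounceTime, Orbit.shift, add_comm]

theorem two_mul_lt_of_lt (h : HasAntipodalOrbits m W V) {o : Orbit W V a b} (h0 : o.InFlight 0 t)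
    (hc : o.InFlight c (t + s)) (hmc : m < c) : 2 * b < s := by
  have hmono := o.strictMono_bounceTime.monotone (by omega : 1 + m ≤ c)
  rw [h.bounceTime_add] at hmono
  linarith [h0.2, hc.1]

theorem lt_two_mul_of_lt (h : HasAntipodalOrbits m W V) {o : Orbit W V a b} (h0 : o.InFlight 0 t)
    (hc : o.InFlight c (t + s)) (hcm : c < m) : s < 2 * b := by
  have hmono := o.strictMono_bounceTime.monotone (by omega : c + 1 ≤ 0 + m)
  rw [h.bounceTime_add] at hmono
  linarith [h0.1, hc.2]

end HasAntipodalOrbits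

/-- The vector `p` can be the momentum of an orbit at some time between two bounces, the first
of which has normal `w`. -/
structure IsFlightPoint (V : Set (EuclideanSpace ℝ ι)) (b : ℝ) (p w : EuclideanSpace ℝ ι) :
    Prop where
  inner_le : ∀ u ∈ V, ⟪u, p⟫ ≤ b
  inner_lt : ∀ u ∈ V, ⟪u, w⟫ < 0 → ⟪u, p⟫ < b
  generic : ∀ u ∈ V, ∀ t : ℝ, 0 < ⟪u, w⟫ → ⟪u, p + t • w⟫ = b → IsGeneric (p + t • w)

theorem Orbit.isFlightPoint (hW : IsVertexSet W) (hV : IsVertexSet V) (o : Orbit W V a b) :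
    IsFlightPoint V b (o.p 0) (o.w 0) where
  inner_le _ hu := (o.facet_p 0).le hu
  inner_lt u hu hneg := ((o.facet_p 0).le hu).lt_of_ne fun hub => by
    rw [(o.facet_p 0).eq_of_inner_eq hV hu hub] at hneg
    exact hneg.not_gt (o.momentum 0).enters
  generic u hu t hpos hub := by
    rw [← sub_neg_eq_add, ← neg_smul] at hub ⊢
    exact (o.facet_p 0).generic.sub_smul (hV.integral _ (o.facet_p 0).active.1)
      (hV.integral u hu) (hW.integral _ (o.facet_q 0).active.1) (o.momentum 0).enters.ne' hpos.ne'
      (hub.trans (o.facet_p 0).level.symm)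

/-- The orbit is found by following the flight backwards, up to the boundary. -/
theorem IsPolarPair.exists_orbit_inFlight (h : IsPolarPair W V) {q p w : EuclideanSpace ℝ ι}
    (hq : IsFacetPoint W a q w) (hp : IsFlightPoint V b p w) :
    ∃ (o : Orbit W V a b) (t : ℝ), o.q 0 = q ∧ o.momentumAt 0 t = p ∧ o.InFlight 0 t := by
  obtain ⟨t, ht, hle, v, hv, hvw, hlevel⟩ := exists_exit h.right.finite hp.inner_le
    (h.exists_inner_neg (neg_ne_zero.2 (h.left.ne_zero w hq.active.1)))
  rw [inner_neg_right, neg_lt_zero] at hvw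
  simp only [smul_neg, sub_neg_eq_add] at hle hlevel
  obtain ⟨o, rfl, hp0⟩ := exists_orbit h.left h.right hq
    ⟨hp.generic v hv t hvw hlevel, ⟨hv, fun u hu => (hle u hu).trans_eq hlevel.symm⟩, hlevel⟩ hvw
  obtain rfl : w = o.w 0 := (o.facet_q 0).eq_of_isActive h.left hq.active
  have hmomentum : o.p 0 - t • o.w 0 = p := by rw [hp0, add_sub_cancel_right]
  have htlam : t ≤ o.lam 0 := (o.momentum 0).le_time (hmomentum ▸ hp.inner_le)
  have hne : t ≠ o.lam 0 := fun heq => by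
    rw [heq, ← o.p_succ] at hmomentum
    have := hp.inner_lt _ (o.facet_p 1).active.1 (o.momentum 0).leaves
    rw [← hmomentum, (o.facet_p _).level] at this
    exact this.false
  refine ⟨o, t, rfl, by simpa [Orbit.momentumAt] using hmomentum, by simpa using ht, ?_⟩
  rw [o.bounceTime_succ, o.bounceTime_zero, zero_add]
  exact htlam.lt_of_ne hne

end Clock

section Merge

variable {k l : ℕ} {W V : Set (EuclideanSpace ℝ (Fin k))} {W' V' : Set (EuclideanSpace ℝ (Fin l))}
  {a a₁ a₂ b : ℝ}

section Parts

variable {q p u w : EuclideanSpace ℝ (Fin k)} {q' p' u' w' : EuclideanSpace ℝ (Fin l)}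

theorem IsFlightPoint.of_glue_left
    (h : IsFlightPoint (sumVertices V V') b (glue p p') (glue w w')) : IsFlightPoint V b p w := by
  obtain ⟨hle, hlt, hgen⟩ := h
  simp only [forall_mem_sumVertices, inner_glue, inner_zero_left, add_zero, ← glue_smul,
    ← glue_add] at hle hlt hgen
  exact ⟨hle.1, hlt.1, fun u hu t hpos hub => (hgen.1 u hu t hpos hub).of_glue_left⟩

theorem IsFlightPoint.of_glue_right
    (h : IsFlightPoint (sumVertices V V') b (glue p p') (glue w w')) :
    IsFlightPoint V' b p' w' := by
  obtain ⟨hle, hlt, hgen⟩ := h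
  simp only [forall_mem_sumVertices, inner_glue, inner_zero_left, zero_add, ← glue_smul,
    ← glue_add] at hle hlt hgen
  exact ⟨hle.2, hlt.2, fun u hu t hpos hub => (hgen.2 u hu t hpos hub).of_glue_right⟩

namespace IsFacetPoint

theorem exists_of_prod {w : EuclideanSpace ℝ (Fin (k + l))}
    (h : IsFacetPoint (prodVertices W W') a (glue q q') w) :
    ∃ w₁ w₂ a₁ a₂, w = glue w₁ w₂ ∧ a = a₁ + a₂ ∧
      IsFacetPoint W a₁ q w₁ ∧ IsFacetPoint W' a₂ q' w₂ := by
  obtain ⟨w₁, w₂, rfl⟩ := exists_eq_glue w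
  have hactive := isActive_prodVertices.1 h.active
  exact ⟨w₁, w₂, _, _, rfl, h.level.symm.trans (inner_glue _ _ _ _),
    ⟨h.generic.of_glue_left, hactive.1, rfl⟩, ⟨h.generic.of_glue_right, hactive.2, rfl⟩⟩

theorem exists_left_of_prod (hW' : IsVertexSet W') {w : EuclideanSpace ℝ (Fin (k + l))}
    (h : IsFacetPoint (prodVertices W W') a (glue q q') w) (ha : a = a₁ + a₂)
    (h' : IsFacetPoint W' a₂ q' w') : ∃ w₁, w = glue w₁ w' ∧ IsFacetPoint W a₁ q w₁ := by
  obtain ⟨w₁, w₂, c₁, c₂, rfl, hc, h₁, h₂⟩ := h.exists_of_prod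
  obtain ⟨rfl, rfl⟩ := h₂.unique hW' h'
  obtain rfl : c₁ = a₁ := by linarith
  exact ⟨w₁, rfl, h₁⟩

theorem exists_right_of_prod (hW : IsVertexSet W) {w : EuclideanSpace ℝ (Fin (k + l))}
    (h : IsFacetPoint (prodVertices W W') a (glue q q') w) (ha : a = a₁ + a₂)
    (h' : IsFacetPoint W a₁ q u) : ∃ w₂, w = glue u w₂ ∧ IsFacetPoint W' a₂ q' w₂ := by
  obtain ⟨w₁, w₂, c₁, c₂, rfl, hc, h₁, h₂⟩ := h.exists_of_prod
  obtain ⟨rfl, rfl⟩ := h₁.unique hW h'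
  obtain rfl : c₂ = a₂ := by linarith
  exact ⟨w₂, rfl, h₂⟩

theorem left_of_sum (hV : IsVertexSet V) (hV' : IsVertexSet V') (hu : u ∈ V)
    (h : IsFacetPoint (sumVertices V V') b (glue p p') (glue u 0)) :
    IsFacetPoint V b p u ∧ ∀ v' ∈ V', ⟪v', p'⟫ < b := by
  have hle := forall_mem_sumVertices_inner_le.1 fun v hv => h.le hv
  have hlevel := h.level
  rw [firstPart_glue, lastPart_glue] at hle
  rw [inner_glue, inner_zero_left, add_zero] at hlevel
  refine ⟨⟨h.generic.of_glue_left, ⟨hu, fun v hv => (hle.1 v hv).trans_eq hlevel.symm⟩, hlevel⟩,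
    fun v' hv' => (hle.2 v' hv').lt_of_ne fun heq => ?_⟩
  have hglue := h.eq_of_inner_eq (hV.sum hV') (Or.inr ⟨v', hv', rfl⟩)
    (by rw [inner_glue, inner_zero_left, zero_add, heq])
  exact hV'.ne_zero v' hv' (glue_inj.1 hglue).2

theorem right_of_sum (hV : IsVertexSet V) (hV' : IsVertexSet V') (hu : u' ∈ V')
    (h : IsFacetPoint (sumVertices V V') b (glue p p') (glue 0 u')) :
    IsFacetPoint V' b p' u' ∧ ∀ v ∈ V, ⟪v, p⟫ < b := by
  have hle := forall_mem_sumVertices_inner_le.1 fun v hv => h.le hv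
  have hlevel := h.level
  rw [firstPart_glue, lastPart_glue] at hle
  rw [inner_glue, inner_zero_left, zero_add] at hlevel
  refine ⟨⟨h.generic.of_glue_right, ⟨hu, fun v hv => (hle.2 v hv).trans_eq hlevel.symm⟩, hlevel⟩,
    fun v hv => (hle.1 v hv).lt_of_ne fun heq => ?_⟩
  have hglue := h.eq_of_inner_eq (hV.sum hV') (Or.inl ⟨v, hv, rfl⟩)
    (by rw [inner_glue, inner_zero_left, add_zero, heq])
  exact hV.ne_zero v hv (glue_inj.1 hglue).1

end IsFacetPoint

end Parts

/-- After `i` bounces the orbit `o` of the sum consists of the orbits `o₁` and `o₂` of the factors,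
which have made `c` and `d` bounces; the clocks of `o₁` and `o₂` are ahead of that of `o` by `t₁`
and `t₂`. -/
structure IsMerged (o : Orbit (prodVertices W W') (sumVertices V V') a b) (o₁ : Orbit W V a₁ b)
    (o₂ : Orbit W' V' a₂ b) (t₁ t₂ : ℝ) (i c d : ℕ) : Prop where
  q_eq : o.q i = glue (o₁.q c) (o₂.q d)
  p_eq : o.p i =
    glue (o₁.momentumAt c (t₁ + o.bounceTime i)) (o₂.momentumAt d (t₂ + o.bounceTime i))
  left : o₁.InFlight c (t₁ + o.bounceTime i)
  right : o₂.InFlight d (t₂ + o.bounceTime i)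

theorem exists_isMerged_zero (h : IsPolarPair W V) (h' : IsPolarPair W' V')
    (o : Orbit (prodVertices W W') (sumVertices V V') a b) :
    ∃ a₁ a₂ t₁ t₂, ∃ (o₁ : Orbit W V a₁ b) (o₂ : Orbit W' V' a₂ b),
      IsMerged o o₁ o₂ t₁ t₂ 0 0 0 := by
  have hflight := o.isFlightPoint (h.left.prod h'.left) (h.right.sum h'.right)
  have hfacet := o.facet_q 0
  obtain ⟨q, q', hq⟩ := exists_eq_glue (o.q 0)
  obtain ⟨p, p', hp⟩ := exists_eq_glue (o.p 0)
  rw [hq] at hfacet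
  obtain ⟨w, w', a₁, a₂, hw, -, hfacet₁, hfacet₂⟩ := hfacet.exists_of_prod
  rw [hp, hw] at hflight
  obtain ⟨o₁, t₁, hq₁, hp₁, hin₁⟩ := h.exists_orbit_inFlight hfacet₁ hflight.of_glue_left
  obtain ⟨o₂, t₂, hq₂, hp₂, hin₂⟩ := h'.exists_orbit_inFlight hfacet₂ hflight.of_glue_right
  refine ⟨a₁, a₂, t₁, t₂, o₁, o₂, ?_, ?_, ?_, ?_⟩
  · rw [hq, hq₁, hq₂]
  all_goals rw [o.bounceTime_zero]
  · rw [hp, add_zero, add_zero, hp₁, hp₂]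
  · rwa [add_zero]
  · rwa [add_zero]

namespace IsMerged

variable {o : Orbit (prodVertices W W') (sumVertices V V') a b} {o₁ : Orbit W V a₁ b}
  {o₂ : Orbit W' V' a₂ b} {t₁ t₂ : ℝ} {i c d : ℕ}

theorem w_eq (hW : IsVertexSet W) (hW' : IsVertexSet W') (h : IsMerged o o₁ o₂ t₁ t₂ i c d) :
    o.w i = glue (o₁.w c) (o₂.w d) := by
  refine ((o.facet_q i).eq_of_isActive (hW.prod hW') ?_).symm
  rw [h.q_eq]
  exact isActive_prodVertices.2 ⟨(o₁.facet_q c).active, (o₂.facet_q d).active⟩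

theorem level_eq (hW : IsVertexSet W) (hW' : IsVertexSet W')
    (h : IsMerged o o₁ o₂ t₁ t₂ i c d) : a = a₁ + a₂ := by
  rw [← (o.facet_q i).level, h.w_eq hW hW', h.q_eq, inner_glue, (o₁.facet_q c).level,
    (o₂.facet_q d).level]

theorem p_succ (hW : IsVertexSet W) (hW' : IsVertexSet W') (h : IsMerged o o₁ o₂ t₁ t₂ i c d) :
    o.p (i + 1) = glue (o₁.momentumAt c (t₁ + o.bounceTime (i + 1)))
      (o₂.momentumAt d (t₂ + o.bounceTime (i + 1))) := by
  rw [o.p_succ, h.p_eq, h.w_eq hW hW', ← glue_smul, ← glue_sub, ← o₁.momentumAt_add,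
    ← o₂.momentumAt_add, add_assoc, add_assoc, ← o.bounceTime_succ]

theorem succ_left (hW : IsVertexSet W) (hV : IsVertexSet V) (hW' : IsVertexSet W')
    (hV' : IsVertexSet V') (h : IsMerged o o₁ o₂ t₁ t₂ i c d) {u : EuclideanSpace ℝ (Fin k)}
    (hu : u ∈ V) (hv : o.v (i + 1) = glue u 0) : IsMerged o o₁ o₂ t₁ t₂ (i + 1) (c + 1) d := by
  have hclock := o.strictMono_bounceTime i.lt_succ_self
  have hp := h.p_succ hW hW'
  have hfacet_p := o.facet_p (i + 1)
  rw [hp, hv] at hfacet_p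
  obtain ⟨hfacet₁, hlt₂⟩ := hfacet_p.left_of_sum hV hV' hu
  obtain ⟨htime, rfl⟩ := o₁.eq_bounceTime_of_isFacetPoint hV h.left (by gcongr) hfacet₁
  have hq : o.q (i + 1) = glue (o₁.q c + o.mu i • o₁.v (c + 1)) (o₂.q d) := by
    rw [o.q_succ, hv, h.q_eq, ← glue_smul, ← glue_add, smul_zero, add_zero]
  have hfacet_q := o.facet_q (i + 1)
  rw [hq] at hfacet_q
  obtain ⟨w, -, hw⟩ := hfacet_q.exists_left_of_prod hW' (h.level_eq hW hW') (o₂.facet_q d)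
  refine ⟨?_, ?_, ?_, h.right.of_inner_lt (by gcongr) hlt₂⟩
  · rw [hq, o₁.q_succ_of_isFacetPoint hW (o.coordinate i).time_pos hw]
  · rw [hp, htime, o₁.momentumAt_bounceTime, o₁.momentumAt_bounceTime_succ]
  · rw [htime]
    exact o₁.inFlight_bounceTime _

theorem succ_right (hW : IsVertexSet W) (hV : IsVertexSet V) (hW' : IsVertexSet W')
    (hV' : IsVertexSet V') (h : IsMerged o o₁ o₂ t₁ t₂ i c d) {u : EuclideanSpace ℝ (Fin l)}
    (hu : u ∈ V') (hv : o.v (i + 1) = glue 0 u) : IsMerged o o₁ o₂ t₁ t₂ (i + 1) c (d + 1) := by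
  have hclock := o.strictMono_bounceTime i.lt_succ_self
  have hp := h.p_succ hW hW'
  have hfacet_p := o.facet_p (i + 1)
  rw [hp, hv] at hfacet_p
  obtain ⟨hfacet₂, hlt₁⟩ := hfacet_p.right_of_sum hV hV' hu
  obtain ⟨htime, rfl⟩ := o₂.eq_bounceTime_of_isFacetPoint hV' h.right (by gcongr) hfacet₂
  have hq : o.q (i + 1) = glue (o₁.q c) (o₂.q d + o.mu i • o₂.v (d + 1)) := by
    rw [o.q_succ, hv, h.q_eq, ← glue_smul, ← glue_add, smul_zero, add_zero]
  have hfacet_q := o.facet_q (i + 1)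
  rw [hq] at hfacet_q
  obtain ⟨w, -, hw⟩ := hfacet_q.exists_right_of_prod hW (h.level_eq hW hW') (o₁.facet_q c)
  refine ⟨?_, ?_, h.left.of_inner_lt (by gcongr) hlt₁, ?_⟩
  · rw [hq, o₂.q_succ_of_isFacetPoint hW' (o.coordinate i).time_pos hw]
  · rw [hp, htime, o₂.momentumAt_bounceTime, o₂.momentumAt_bounceTime_succ]
  · rw [htime]
    exact o₂.inFlight_bounceTime _

theorem exists_isMerged (hW : IsVertexSet W) (hV : IsVertexSet V) (hW' : IsVertexSet W')
    (hV' : IsVertexSet V') (h : IsMerged o o₁ o₂ t₁ t₂ 0 0 0) (i : ℕ) :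
    ∃ c d, c + d = i ∧ IsMerged o o₁ o₂ t₁ t₂ i c d := by
  induction i with
  | zero => exact ⟨0, 0, rfl, h⟩
  | succ i ih =>
    obtain ⟨c, d, rfl, hi⟩ := ih
    rcases (o.facet_p (c + d + 1)).active.1 with ⟨u, hu, hv⟩ | ⟨u, hu, hv⟩
    · exact ⟨c + 1, d, by ring, hi.succ_left hW hV hW' hV' hu hv.symm⟩
    · exact ⟨c, d + 1, by ring, hi.succ_right hW hV hW' hV' hu hv.symm⟩

end IsMerged

theorem HasAntipodalOrbits.oneSum {m₁ m₂ : ℕ} (h : IsPolarPair W V) (h' : IsPolarPair W' V')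
    (hWV : HasAntipodalOrbits m₁ W V) (hWV' : HasAntipodalOrbits m₂ W' V') :
    HasAntipodalOrbits (m₁ + m₂) (prodVertices W W') (sumVertices V V') := by
  intro a b o
  have hW := h.left.prod h'.left
  have hV := h.right.sum h'.right
  obtain ⟨a₁, a₂, t₁, t₂, o₁, o₂, h0⟩ := exists_isMerged_zero h h' o
  obtain ⟨c, d, hcd, hm⟩ := h0.exists_isMerged h.left h.right h'.left h'.right (m₁ + m₂)
  obtain ⟨hin₁, hin₂⟩ : o₁.InFlight 0 t₁ ∧ o₂.InFlight 0 t₂ := by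
    simpa using And.intro h0.left h0.right
  obtain ⟨rfl, rfl⟩ : c = m₁ ∧ d = m₂ := by
    rcases lt_trichotomy c m₁ with hlt | rfl | hlt
    · exact absurd (hWV.lt_two_mul_of_lt hin₁ hm.left hlt)
        (hWV'.two_mul_lt_of_lt hin₂ hm.right (by omega)).not_gt
    · exact ⟨rfl, by omega⟩
    · exact absurd (hWV.two_mul_lt_of_lt hin₁ hm.left hlt)
        (hWV'.lt_two_mul_of_lt hin₂ hm.right (by omega)).not_gt
  have hq : o.q (c + d) = -o.q 0 := by
    rw [hm.q_eq, h0.q_eq, (hWV _ _ o₁).q_eq, (hWV' _ _ o₂).q_eq, glue_neg]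
  have hp : o.p (c + d) = -(o.p 0 + (2 * b - o.bounceTime (c + d)) • o.w 0) := by
    rw [hm.p_eq, h0.p_eq, h0.w_eq h.left h'.left, o.bounceTime_zero, add_zero, add_zero,
      (hWV _ _ o₁).momentumAt_add h.left, (hWV' _ _ o₂).momentumAt_add h'.left, glue_neg, glue_add,
      glue_smul]
  have htime := o.eq_zero_of_antipodal hW hV hq hp
  rw [htime, zero_smul, add_zero] at hp
  have sum_lam : ∑ i ∈ Finset.range (c + d), o.lam i = 2 * b := (sub_eq_zero.1 htime).symm
  refine ⟨hq, hp, sum_lam, mul_left_cancel₀ ((o.facet_p 0).pos hV).ne' ?_⟩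
  rw [o.mul_sum_mu_of_antipodal hq hp, sum_lam]
  ring

end Merge

/-! ### Hanner polytopes -/

section Segment

/-- The vertices of the segment `[-1, 1]`. -/
def segmentVertices : Set (EuclideanSpace ℝ (Fin 1)) :=
  {EuclideanSpace.single 0 1, -EuclideanSpace.single 0 1}

theorem forall_mem_segmentVertices_inner_le {x : EuclideanSpace ℝ (Fin 1)} {a : ℝ} :
    (∀ w ∈ segmentVertices, ⟪w, x⟫ ≤ a) ↔ |x 0| ≤ a := by
  simp [segmentVertices, EuclideanSpace.inner_single_left, abs_le']

theorem vertexPolar_segmentVertices :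
    vertexPolar segmentVertices = {x | -1 ≤ x 0 ∧ x 0 ≤ 1} :=
  ext fun _ => forall_mem_segmentVertices_inner_le.trans abs_le

theorem isVertexSet_segmentVertices : IsVertexSet segmentVertices where
  finite := (finite_singleton _).insert _
  nonempty := insert_nonempty _ _
  neg_mem := by simp [segmentVertices]
  integral := by
    have hmem : EuclideanSpace.single 0 1 ∈ intLattice (Fin 1) :=
      mem_intLattice.2 ⟨1, by ext i; simp [Subsingleton.elim i 0]⟩
    rintro w (rfl | rfl)
    exacts [hmem, neg_mem hmem]
  ne_zero := by
    rintro w (rfl | rfl) <;> simp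

theorem isPolarPair_segmentVertices : IsPolarPair segmentVertices segmentVertices where
  left := isVertexSet_segmentVertices
  right := isVertexSet_segmentVertices
  inner_le_one := by
    rintro w (rfl | rfl) v (rfl | rfl) <;> simp
  inner_le_mul q p a b hq hp := by
    rw [forall_mem_segmentVertices_inner_le] at hq hp
    calc ⟪p, q⟫ = q 0 * p 0 := by simp [PiLp.inner_apply]
      _ ≤ |q 0| * |p 0| := (le_abs_self _).trans_eq (abs_mul _ _)
      _ ≤ a * b := mul_le_mul hq hp (abs_nonneg _) ((abs_nonneg _).trans hq)

variable {v w : EuclideanSpace ℝ (Fin 1)}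

theorem inner_smul_of_mem_segmentVertices (hw : w ∈ segmentVertices)
    (x : EuclideanSpace ℝ (Fin 1)) : ⟪w, x⟫ • w = x := by
  ext i
  rcases hw with rfl | rfl <;> simp [Subsingleton.elim i 0, EuclideanSpace.inner_single_left]

theorem eq_of_mem_segmentVertices_of_inner_pos (hv : v ∈ segmentVertices)
    (hw : w ∈ segmentVertices) (h : 0 < ⟪v, w⟫) : v = w := by
  rcases hv with rfl | rfl <;> rcases hw with rfl | rfl
  all_goals first | rfl | exact absurd h (by norm_num)

theorem hasAntipodalOrbits_segmentVertices :
    HasAntipodalOrbits 1 segmentVertices segmentVertices := by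
  intro a b o
  have hV := isVertexSet_segmentVertices
  have hv (i : ℕ) : o.v i ∈ segmentVertices := (o.facet_p i).active.1
  have hw (i : ℕ) : o.w i ∈ segmentVertices := (o.facet_q i).active.1
  have hv0 : o.v 0 = o.w 0 := eq_of_mem_segmentVertices_of_inner_pos (hv 0) (hw 0)
    (o.momentum 0).enters
  have hv1 : o.v 1 = -o.w 0 := eq_of_mem_segmentVertices_of_inner_pos (hv 1)
    (hV.neg_mem _ (hw 0)) (by simpa using (o.momentum 0).leaves)
  have hw1 : o.w 1 = o.v 1 := eq_of_mem_segmentVertices_of_inner_pos (hw 1) (hv 1)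
    (by simpa using (o.coordinate 0).leaves)
  have q_eq (i : ℕ) : o.q i = a • o.w i := by
    simpa only [(o.facet_q i).level] using
      (inner_smul_of_mem_segmentVertices (hw i) (o.q i)).symm
  have p_eq (i : ℕ) : o.p i = b • o.v i := by
    simpa only [(o.facet_p i).level] using
      (inner_smul_of_mem_segmentVertices (hv i) (o.p i)).symm
  have hq : o.q 1 = -o.q 0 := by rw [q_eq, q_eq, hw1, hv1, smul_neg]
  have hp : o.p 1 = -o.p 0 := by rw [p_eq, p_eq, hv1, hv0, smul_neg]
  have sum_lam : ∑ i ∈ Finset.range 1, o.lam i = 2 * b := by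
    refine smul_left_injective ℝ (hV.ne_zero _ (hw 0)) ?_
    have hsucc := o.p_succ 0
    rw [hp, p_eq, hv0] at hsucc
    simp only [Finset.sum_range_one]
    linear_combination (norm := module) hsucc
  refine ⟨hq, hp, sum_lam, mul_left_cancel₀ ((o.facet_p 0).pos hV).ne' ?_⟩
  rw [o.mul_sum_mu_of_antipodal hq hp, sum_lam]
  ring

end Segment

section Hanner

variable {k l : ℕ} {W : Set (EuclideanSpace ℝ (Fin k))} {W' : Set (EuclideanSpace ℝ (Fin l))}

theorem IsVertexSet.exists_isActive_gauge {ι : Type*} [Fintype ι] {W : Set (EuclideanSpace ℝ ι)}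
    (hW : IsVertexSet W) (q : EuclideanSpace ℝ ι) :
    ∃ w, IsActive W q w ∧ gauge (vertexPolar W) q = ⟪w, q⟫ := by
  obtain ⟨w, hw⟩ := exists_isActive hW.finite hW.nonempty q
  exact ⟨w, hw, gauge_vertexPolar hw (hw.nonneg hW)⟩

theorem oneSum_vertexPolar (hW : IsVertexSet W) (hW' : IsVertexSet W') :
    oneSum (vertexPolar W) (vertexPolar W') = vertexPolar (prodVertices W W') := by
  ext q
  obtain ⟨w, hw, hgauge⟩ := hW.exists_isActive_gauge (firstPart q)
  obtain ⟨w', hw', hgauge'⟩ := hW'.exists_isActive_gauge (lastPart q)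
  simp only [oneSum, mem_ofPred_eq, hgauge, hgauge']
  refine ⟨fun h => forall_mem_prodVertices.2 fun u hu u' hu' => ?_, fun h => ?_⟩
  · exact inner_glue_left u u' q ▸ (add_le_add (hw.2 u hu) (hw'.2 u' hu')).trans h
  · exact inner_glue_left w w' q ▸ h _ (mem_image2_of_mem hw.1 hw'.1)

theorem infSum_vertexPolar (hW : IsVertexSet W) (hW' : IsVertexSet W') :
    infSum (vertexPolar W) (vertexPolar W') = vertexPolar (sumVertices W W') := by
  ext q
  obtain ⟨w, hw, hgauge⟩ := hW.exists_isActive_gauge (firstPart q)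
  obtain ⟨w', hw', hgauge'⟩ := hW'.exists_isActive_gauge (lastPart q)
  simp only [infSum, mem_ofPred_eq, hgauge, hgauge', max_le_iff]
  refine Iff.trans (and_congr ?_ ?_) forall_mem_sumVertices_inner_le.symm
  · exact ⟨fun h u hu => (hw.2 u hu).trans h, fun h => h w hw.1⟩
  · exact ⟨fun h u hu => (hw'.2 u hu).trans h, fun h => h w' hw'.1⟩

theorem IsHannerPolytope.exists_vertices {n : ℕ} {H : Set (EuclideanSpace ℝ (Fin n))}
    (hH : IsHannerPolytope n H) :
    ∃ W V, IsPolarPair W V ∧ HasAntipodalOrbits n W V ∧ H = vertexPolar W := by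
  induction hH with
  | segment =>
    exact ⟨_, _, isPolarPair_segmentVertices, hasAntipodalOrbits_segmentVertices,
      vertexPolar_segmentVertices.symm⟩
  | oneSum _ _ ih ih' =>
    obtain ⟨W, V, h, hWV, rfl⟩ := ih
    obtain ⟨W', V', h', hWV', rfl⟩ := ih'
    exact ⟨_, _, h.oneSum h', HasAntipodalOrbits.oneSum h h' hWV hWV',
      oneSum_vertexPolar h.left h'.left⟩
  | infSum _ _ ih ih' =>
    obtain ⟨W, V, h, hWV, rfl⟩ := ih
    obtain ⟨W', V', h', hWV', rfl⟩ := ih'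
    have hsum := h.symm.oneSum h'.symm
    exact ⟨_, _, hsum.symm,
      HasAntipodalOrbits.symm hsum.right hsum.left (HasAntipodalOrbits.oneSum h.symm h'.symm
        (hWV.symm h.right h.left) (hWV'.symm h'.right h'.left)),
      infSum_vertexPolar h.left h'.left⟩

end Hanner

/-! ### Orbits are classical trajectories -/

section Trajectory

variable {n m : ℕ} {W V : Set (EuclideanSpace ℝ (Fin n))} {q p w v x : EuclideanSpace ℝ (Fin n)}
  {a b t : ℝ}

namespace IsPolarPair

theorem polarBody_vertexPolar (h : IsPolarPair W V) :
    polarBody (vertexPolar W) = vertexPolar V := by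
  ext p
  refine ⟨fun hp v hv => ?_, fun hp q hq => by simpa using h.inner_le_mul q p 1 1 hq hp⟩
  rw [real_inner_comm]
  exact hp v fun w hw => h.inner_le_one w hw v hv

theorem bodyNorm_eq (h : IsPolarPair W V) (hw : IsActive W q w) :
    bodyNorm (vertexPolar V) q = ⟪w, q⟫ := by
  refine IsGreatest.csSup_eq ⟨⟨w, fun v hv => h.symm.inner_le_one v hv w hw.1, rfl⟩, ?_⟩
  rintro _ ⟨p, hp, rfl⟩
  simpa using h.inner_le_mul q p _ 1 hw.2 hp

theorem inner_le_bodyNorm (h : IsPolarPair W V) (hp : p ∈ vertexPolar V)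
    (q : EuclideanSpace ℝ (Fin n)) : ⟪p, q⟫ ≤ bodyNorm (vertexPolar V) q := by
  obtain ⟨w, hw⟩ := exists_isActive h.left.finite h.left.nonempty q
  rw [h.bodyNorm_eq hw]
  simpa using h.inner_le_mul q p _ 1 hw.2 hp

theorem bodyNorm_smul (h : IsPolarPair W V) (ht : 0 ≤ t) (hv : v ∈ V) (hp : p ∈ vertexPolar V)
    (hvp : ⟪v, p⟫ = 1) : bodyNorm (vertexPolar V) (t • v) = t := by
  refine le_antisymm ?_ ?_
  · obtain ⟨w, hw⟩ := exists_isActive h.left.finite h.left.nonempty (t • v)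
    rw [h.bodyNorm_eq hw, inner_smul_right]
    exact mul_le_of_le_one_right ht (h.inner_le_one w hw.1 v hv)
  · have := h.inner_le_bodyNorm hp (t • v)
    rwa [inner_smul_right, real_inner_comm, hvp, mul_one] at this

end IsPolarPair

theorem IsFacetPoint.eventually_isActive (hW : IsVertexSet W) (h : IsFacetPoint W a q w) :
    ∀ᶠ x in nhds q, IsActive W x w := by
  have hmax : ∀ᶠ x in nhds q, ∀ u ∈ W, ⟪u, x⟫ ≤ ⟪w, x⟫ := by
    refine (Filter.eventually_all_finite hW.finite).2 fun u hu => ?_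
    rcases (h.le hu).eq_or_lt with heq | hlt
    · exact .of_forall fun x => (h.eq_of_inner_eq hW hu heq ▸ le_rfl)
    · rw [← h.level] at hlt
      exact ((continuous_const.inner continuous_id).continuousAt.eventually_lt
        (continuous_const.inner continuous_id).continuousAt hlt).mono fun x hx => hx.le
  exact hmax.mono fun x hx => ⟨h.active.1, hx⟩

namespace IsPolarPair

theorem hasGradientAt_bodyNorm (h : IsPolarPair W V) (hq : IsFacetPoint W a q w) :
    HasGradientAt (bodyNorm (vertexPolar V)) w q := by
  have hlinear : HasGradientAt (fun x => ⟪w, x⟫) w q :=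
    hasGradientAt_iff_hasFDerivAt.2 (InnerProductSpace.toDual ℝ _ w).hasFDerivAt
  exact hlinear.congr_of_eventuallyEq
    ((hq.eventually_isActive h.left).mono fun x hx => h.bodyNorm_eq hx)

theorem outerNormal_eq (h : IsPolarPair W V) (hq : IsFacetPoint W a q w) :
    outerNormal (vertexPolar W) q = w := by
  rw [outerNormal, h.polarBody_vertexPolar]
  exact (h.hasGradientAt_bodyNorm hq).gradient

end IsPolarPair

namespace IsVertexSet

theorem mem_frontier_vertexPolar (hW : IsVertexSet W) :
    q ∈ frontier (vertexPolar W) ↔ (∀ w ∈ W, ⟪w, q⟫ ≤ 1) ∧ ∃ w ∈ W, ⟪w, q⟫ = 1 :=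
  Billiard.mem_frontier_vertexPolar hW.finite hW.ne_zero

theorem inner_eq_one_of_mem_frontier (hW : IsVertexSet W) (h : IsActive W q w)
    (hq : q ∈ frontier (vertexPolar W)) : ⟪w, q⟫ = 1 := by
  obtain ⟨hle, u, hu, heq⟩ := hW.mem_frontier_vertexPolar.1 hq
  exact (hle w h.1).antisymm (heq ▸ h.2 u hu)

theorem exists_isFacetPoint (hW : IsVertexSet W) (hgen : IsGeneric q)
    (hq : q ∈ frontier (vertexPolar W)) : ∃ w, IsFacetPoint W 1 q w := by
  obtain ⟨w, hw⟩ := exists_isActive hW.finite hW.nonempty q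
  exact ⟨w, hgen, hw, hW.inner_eq_one_of_mem_frontier hw hq⟩

end IsVertexSet

theorem IsFacetPoint.mem_frontier (hW : IsVertexSet W) (h : IsFacetPoint W 1 q w) :
    q ∈ frontier (vertexPolar W) :=
  hW.mem_frontier_vertexPolar.2 ⟨fun _ hu => h.le hu, w, h.active.1, h.level⟩

theorem IsPolarPair.isSmoothBoundaryPoint (h : IsPolarPair W V) (hq : IsFacetPoint W 1 q w) :
    IsSmoothBoundaryPoint (vertexPolar W) q := by
  refine ⟨hq.mem_frontier h.left, ?_⟩
  rw [h.polarBody_vertexPolar]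
  exact (h.hasGradientAt_bodyNorm hq).differentiableAt

namespace Orbit

theorem bodyNorm_sub (h : IsPolarPair W V) (o : Orbit W V a 1) (i : ℕ) :
    bodyNorm (vertexPolar V) (o.q (i + 1) - o.q i) = o.mu i := by
  rw [o.q_succ, add_sub_cancel_left]
  exact h.bodyNorm_smul (o.coordinate i).time_pos.le (o.facet_p _).active.1
    (fun _ hu => (o.facet_p _).le hu) (o.facet_p _).level

theorem mu_add_mu_eq (o : Orbit W V a 1) (i : ℕ) (hx : ⟪o.w (i + 1), x⟫ = a) :
    o.mu (i + 1) + o.mu i =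
      ⟪o.p (i + 2), o.q (i + 2) - x⟫ + ⟪o.p (i + 1), x - o.q i⟫ := by
  have reflection : ⟪o.p (i + 2), x - o.q (i + 1)⟫ = ⟪o.p (i + 1), x - o.q (i + 1)⟫ := by
    rw [o.p_succ (i + 1), inner_sub_left, real_inner_smul_left, inner_sub_right (o.w (i + 1)), hx,
      (o.facet_q (i + 1)).level, sub_self, mul_zero, sub_zero]
  have hmu := o.inner_p_sub i
  have hmu' := o.inner_p_sub (i + 1)
  rw [one_mul] at hmu hmu'
  rw [← hmu, ← hmu']
  simp only [inner_sub_right] at reflection ⊢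
  linarith

theorem hasBilliardReflection (h : IsPolarPair W V) (o : Orbit W V 1 1) (i : ℕ) :
    HasBilliardReflection (vertexPolar W) (vertexPolar V) (o.q i) (o.q (i + 1)) (o.q (i + 2)) := by
  have q_mem (j : ℕ) : o.q j ∈ vertexPolar W := fun _ hu => (o.facet_q j).le hu
  have p_mem (j : ℕ) : o.p j ∈ vertexPolar V := fun _ hu => (o.facet_p j).le hu
  refine ⟨q_mem _, (o.facet_q _).mem_frontier h.left, q_mem _, ?_⟩
  filter_upwards [((o.facet_q (i + 1)).eventually_isActive h.left).filter_mono nhdsWithin_le_nhds,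
    self_mem_nhdsWithin] with x hx hfrontier
  rw [o.bodyNorm_sub h i, o.bodyNorm_sub h (i + 1),
    o.mu_add_mu_eq i (h.left.inner_eq_one_of_mem_frontier hx hfrontier)]
  exact add_le_add (h.inner_le_bodyNorm (p_mem _) _) (h.inner_le_bodyNorm (p_mem _) _)

theorem isClassicalTrajectory (h : IsPolarPair W V) (o : Orbit W V 1 1) :
    IsClassicalTrajectory (vertexPolar W) (vertexPolar V) o.q o.p where
  smooth_coordinate i := h.isSmoothBoundaryPoint (o.facet_q i)
  smooth_momentum i := h.symm.isSmoothBoundaryPoint (o.facet_p i)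
  momentum_change i := ⟨o.lam i, (o.momentum i).time_pos, by
    rw [h.outerNormal_eq (o.facet_q i), o.p_succ, sub_sub_cancel_left]⟩
  coordinate_change i := ⟨o.mu i, (o.coordinate i).time_pos, by
    rw [h.symm.outerNormal_eq (o.facet_p _), o.q_succ, add_sub_cancel_left]⟩
  reflection := o.hasBilliardReflection h

theorem eq_of_isClassicalTrajectory (h : IsPolarPair W V) (o : Orbit W V 1 1)
    {q p : ℕ → EuclideanSpace ℝ (Fin n)}
    (h' : IsClassicalTrajectory (vertexPolar W) (vertexPolar V) q p) (hq : q 0 = o.q 0)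
    (hp : p 0 = o.p 0) (i : ℕ) : q i = o.q i ∧ p i = o.p i := by
  induction i with
  | zero => exact ⟨hq, hp⟩
  | succ i ih =>
    obtain ⟨s, hs, hps⟩ := h'.momentum_change i
    obtain ⟨t, ht, hqt⟩ := h'.coordinate_change i
    obtain ⟨hple, v, hv, hpv⟩ := h.right.mem_frontier_vertexPolar.1 (h'.smooth_momentum (i + 1)).1
    obtain ⟨hqle, w, hw, hqw⟩ := h.left.mem_frontier_vertexPolar.1 (h'.smooth_coordinate (i + 1)).1
    rw [ih.1, ih.2, h.outerNormal_eq (o.facet_q i), sub_eq_iff_eq_add, neg_add_eq_sub] at hps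
    have p_eq : p (i + 1) = o.p (i + 1) := by
      rw [hps] at hple hpv ⊢
      rw [o.p_succ, (o.momentum i).time_unique h.right hs hple hv hpv]
    rw [ih.1, p_eq, h.symm.outerNormal_eq (o.facet_p _), sub_eq_iff_eq_add', ← sub_neg_eq_add,
      ← smul_neg] at hqt
    refine ⟨?_, p_eq⟩
    rw [hqt] at hqle hqw ⊢
    rw [(o.coordinate i).eq, (o.coordinate i).time_unique h.left ht hqle hw hqw]

theorem two_mul_le_sum_mu (h : IsPolarPair W V) (o : Orbit W V a b) (hq : o.q m = -o.q 0) :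
    2 * a ≤ ∑ i ∈ Finset.range m, o.mu i := by
  have step (i : ℕ) : ⟪-o.w 0, o.q (i + 1)⟫ - ⟪-o.w 0, o.q i⟫ ≤ o.mu i := by
    rw [← inner_sub_right, o.q_succ, add_sub_cancel_left, inner_smul_right]
    exact mul_le_of_le_one_right (o.coordinate i).time_pos.le
      (h.inner_le_one _ (h.left.neg_mem _ (o.facet_q 0).active.1) _ (o.facet_p _).active.1)
  calc 2 * a = ⟪-o.w 0, o.q m⟫ - ⟪-o.w 0, o.q 0⟫ := by
        rw [hq, inner_neg_neg, inner_neg_left, (o.facet_q 0).level]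
        ring
    _ = ∑ i ∈ Finset.range m, (⟪-o.w 0, o.q (i + 1)⟫ - ⟪-o.w 0, o.q i⟫) :=
        (Finset.sum_range_sub (fun i => ⟪-o.w 0, o.q i⟫) m).symm
    _ ≤ ∑ i ∈ Finset.range m, o.mu i := Finset.sum_le_sum fun i _ => step i

end Orbit

namespace HasAntipodalOrbits

theorem q_add (h : HasAntipodalOrbits m W V) (o : Orbit W V a b) (i : ℕ) :
    o.q (i + m) = -o.q i := by
  simpa [Orbit.shift, add_comm] using (h a b (o.shift i)).q_eq

theorem p_add (h : HasAntipodalOrbits m W V) (o : Orbit W V a b) (i : ℕ) :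
    o.p (i + m) = -o.p i := by
  simpa [Orbit.shift, add_comm] using (h a b (o.shift i)).p_eq

theorem pos (hW : IsVertexSet W) (h : HasAntipodalOrbits m W V) (o : Orbit W V a b) : 0 < m := by
  rw [Nat.pos_iff_ne_zero]
  rintro rfl
  have := (h a b o).sum_mu
  rw [Finset.sum_range_zero] at this
  linarith [(o.facet_q 0).pos hW]

theorem isClosedTrajectory (hW : IsVertexSet W) (h : HasAntipodalOrbits m W V)
    (o : Orbit W V a b) : IsClosedTrajectory (2 * m) o.q o.p := by
  have := h.pos hW o
  refine ⟨by omega, fun i => ?_⟩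
  rw [two_mul, ← add_assoc, h.q_add, h.q_add, h.p_add, h.p_add, neg_neg, neg_neg]
  exact ⟨rfl, rfl⟩

theorem closedLength_eq (h : IsPolarPair W V) (h' : HasAntipodalOrbits m W V)
    (o : Orbit W V a 1) : closedLength (vertexPolar V) (2 * m) o.q = 4 * a := by
  have second : ∑ i ∈ Finset.range m, o.mu (m + i) = 2 * a := by
    simpa only [Orbit.shift, add_comm] using (h' a 1 (o.shift m)).sum_mu
  simp only [closedLength, o.bodyNorm_sub h]
  rw [two_mul, Finset.sum_range_add, (h' a 1 o).sum_mu, second]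
  ring

theorem le_of_q_eq_neg (h : IsPolarPair W V) (h' : HasAntipodalOrbits m W V) (o : Orbit W V a b)
    {j : ℕ} (hq : o.q j = -o.q 0) : m ≤ j := by
  by_contra! hlt
  have hsum : ∑ i ∈ Finset.range j, o.mu i < ∑ i ∈ Finset.range m, o.mu i :=
    Finset.sum_lt_sum_of_subset (Finset.range_subset_range.2 hlt.le) (Finset.mem_range.2 hlt)
      Finset.notMem_range_self (o.coordinate j).time_pos fun i _ _ => (o.coordinate i).time_pos.le
  rw [(h' a b o).sum_mu] at hsum
  exact hsum.not_ge (o.two_mul_le_sum_mu h hq)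

theorem isSimpleTrajectory (h : IsPolarPair W V) (h' : HasAntipodalOrbits m W V)
    (o : Orbit W V a b) : IsSimpleTrajectory (2 * m) o.q := by
  intro d hd hdm
  by_contra! hperiod
  rcases le_total d m with hle | hle
  · have hq : o.q (m - d) = -o.q 0 := by
      rw [← hperiod, Nat.sub_add_cancel hle, (h' a b o).q_eq]
    have := h'.le_of_q_eq_neg h o hq
    omega
  · have hq : o.q (d - m) = -o.q 0 := by
      rw [← hperiod 0, zero_add, eq_neg_iff_add_eq_zero, ← neg_eq_iff_add_eq_zero, ← h'.q_add,
        Nat.sub_add_cancel hle]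
    have := h'.le_of_q_eq_neg h o hq
    omega

end HasAntipodalOrbits

theorem IsPolarPair.exists_isFacetPoint_of_isAdmissiblePosition (h : IsPolarPair W V)
    (hq : IsGeneric q) (hp : IsGeneric p)
    (hadm : IsAdmissiblePosition (vertexPolar W) (vertexPolar V) q p) :
    ∃ w v, IsFacetPoint W 1 q w ∧ IsFacetPoint V 1 p v ∧ 0 < ⟪v, w⟫ := by
  obtain ⟨⟨hqf, -⟩, hpf, ε, hε, hinterior⟩ := hadm
  obtain ⟨w, hw⟩ := h.left.exists_isFacetPoint hq hqf
  obtain ⟨v, hv⟩ := h.right.exists_isFacetPoint hp hpf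
  refine ⟨w, v, hw, hv, ?_⟩
  have hlt := inner_lt_one_of_mem_interior hv.active.1 (h.right.ne_zero _ hv.active.1)
    (hinterior (ε / 2) (by linarith) (by linarith))
  rw [h.outerNormal_eq hw, inner_sub_right, inner_smul_right, hv.level] at hlt
  exact pos_of_mul_pos_right (by linarith : 0 < ε / 2 * ⟪v, w⟫) (by linarith)

theorem IsPolarPair.exists_generates (h : IsPolarPair W V) (h' : HasAntipodalOrbits m W V)
    (hq : IsGeneric q) (hp : IsGeneric p)
    (hadm : IsAdmissiblePosition (vertexPolar W) (vertexPolar V) q p) :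
    ∃ q' p' : ℕ → EuclideanSpace ℝ (Fin n),
      Generates (vertexPolar W) (vertexPolar V) q p q' p' ∧ IsClosedTrajectory (2 * m) q' p' ∧
        IsSimpleTrajectory (2 * m) q' ∧ closedLength (vertexPolar V) (2 * m) q' = 4 := by
  obtain ⟨w, v, hw, hv, hvw⟩ := h.exists_isFacetPoint_of_isAdmissiblePosition hq hp hadm
  obtain ⟨o, rfl, rfl⟩ := exists_orbit h.left h.right hw hv hvw
  refine ⟨o.q, o.p, ⟨⟨o.isClassicalTrajectory h, rfl, rfl⟩, fun q' p' hclass hq' hp' => ?_⟩,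
    h'.isClosedTrajectory h.left o, h'.isSimpleTrajectory h o,
    (h'.closedLength_eq h o).trans (mul_one 4)⟩
  have heq := o.eq_of_isClassicalTrajectory h hclass hq' hp'
  exact ⟨funext fun i => (heq i).1, funext fun i => (heq i).2⟩

end Trajectory

/-! ### Almost all positions are generic -/

section Measure

theorem hausdorffMeasure_fiber_eq_zero {F G : Type*} [NormedAddCommGroup F] [NormedSpace ℝ F]
    [FiniteDimensional ℝ F] [MeasurableSpace F] [BorelSpace F] [AddCommGroup G] [Module ℝ G]
    (f : F →ₗ[ℝ] G) {r : ℝ} (hr : Module.finrank ℝ (LinearMap.ker f) < r) (y : G) :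
    Measure.hausdorffMeasure r (f ⁻¹' {y}) = 0 := by
  rcases (f ⁻¹' {y}).eq_empty_or_nonempty with hempty | ⟨x, hx⟩
  · rw [hempty, measure_empty]
  have isometry : Isometry fun u : LinearMap.ker f => x + u :=
    (IsometryEquiv.addLeft x).isometry.comp isometry_subtype_coe
  have fiber_eq : f ⁻¹' {y} = range fun u : LinearMap.ker f => x + u := by
    ext z
    refine ⟨fun hz => ⟨⟨z - x, ?_⟩, add_sub_cancel x z⟩, ?_⟩
    · rw [LinearMap.mem_ker, map_sub, hz, hx, sub_self]
    · rintro ⟨u, rfl⟩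
      simpa using hx
  rw [fiber_eq, ← image_univ,
    isometry.hausdorffMeasure_image (Or.inl ((Nat.cast_nonneg _).trans hr.le)),
    Real.hausdorffMeasure_of_finrank_lt hr, Measure.coe_zero, Pi.zero_apply]

variable {n : ℕ} {v w c : EuclideanSpace ℝ (Fin n)}

theorem hausdorffMeasure_inner_fst_eq_zero (hv : v ≠ 0) (hc : c ≠ 0) :
    Measure.hausdorffMeasure (2 * (n : ℝ) - 2)
      {x : EuclideanSpace ℝ (Fin n) × EuclideanSpace ℝ (Fin n) |
        ⟪w, x.1⟫ = 1 ∧ ⟪c, x.1⟫ = 0 ∧ ⟪v, x.2⟫ = 1} = 0 := by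
  by_cases hex : ∃ q, ⟪w, q⟫ = 1 ∧ ⟪c, q⟫ = 0
  · obtain ⟨q, hwq, hcq⟩ := hex
    let f := ((innerₛₗ ℝ w).prod (innerₛₗ ℝ c)).prodMap (innerₛₗ ℝ v)
    have surjective : LinearMap.range f = ⊤ := by
      refine LinearMap.range_eq_top.2 fun ⟨⟨a, b⟩, d⟩ =>
        ⟨(a • q + (b / ‖c‖ ^ 2) • (c - ⟪w, c⟫ • q), (d / ‖v‖ ^ 2) • v), ?_⟩
      simp [f, inner_add_right, inner_sub_right, inner_smul_right, hwq, hcq, hc, hv]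
    have finrank_ker : Module.finrank ℝ (LinearMap.ker f) + 3 = 2 * n := by
      have := f.finrank_range_add_finrank_ker
      rw [surjective, finrank_top] at this
      simp only [Module.finrank_prod, Module.finrank_self, finrank_euclideanSpace_fin] at this
      omega
    convert hausdorffMeasure_fiber_eq_zero f ?_ ((1, 0), 1) using 2
    · ext x
      simp [f, and_assoc]
    · have : (Module.finrank ℝ (LinearMap.ker f) : ℝ) + 3 = 2 * n := mod_cast finrank_ker
      linarith
  · exact measure_mono_null (fun x hx => hex ⟨x.1, hx.1, hx.2.1⟩) measure_empty

theorem hausdorffMeasure_inner_snd_eq_zero (hw : w ≠ 0) (hc : c ≠ 0) :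
    Measure.hausdorffMeasure (2 * (n : ℝ) - 2)
      {x : EuclideanSpace ℝ (Fin n) × EuclideanSpace ℝ (Fin n) |
        ⟪v, x.2⟫ = 1 ∧ ⟪c, x.2⟫ = 0 ∧ ⟪w, x.1⟫ = 1} = 0 := by
  have isometry_swap :
      Isometry (Prod.swap : EuclideanSpace ℝ (Fin n) × EuclideanSpace ℝ (Fin n) → _) :=
    fun x y => by simp [Prod.edist_eq, max_comm]
  rw [← hausdorffMeasure_inner_fst_eq_zero (w := v) hw hc,
    ← isometry_swap.hausdorffMeasure_image (Or.inr Prod.swap_surjective),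
    image_swap_eq_preimage_swap]
  rfl

theorem ae_boundaryMeasure_isGeneric {W V : Set (EuclideanSpace ℝ (Fin n))} (hW : IsVertexSet W)
    (hV : IsVertexSet V) :
    ∀ᵐ x ∂(boundaryMeasure (vertexPolar W) (vertexPolar V)), IsGeneric x.1 ∧ IsGeneric x.2 := by
  have ae_no_relation : ∀ᵐ x : EuclideanSpace ℝ (Fin n) × EuclideanSpace ℝ (Fin n)
      ∂(Measure.hausdorffMeasure (2 * (n : ℝ) - 2)), ∀ w ∈ W, ∀ v ∈ V,
      ∀ c ∈ (intLattice (Fin n) : Set (EuclideanSpace ℝ (Fin n))), c ≠ 0 →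
        ¬(⟪w, x.1⟫ = 1 ∧ ⟪c, x.1⟫ = 0 ∧ ⟪v, x.2⟫ = 1) ∧
        ¬(⟪v, x.2⟫ = 1 ∧ ⟪c, x.2⟫ = 0 ∧ ⟪w, x.1⟫ = 1) := by
    refine (ae_ball_iff hW.finite.countable).2 fun w hw =>
      (ae_ball_iff hV.finite.countable).2 fun v hv =>
        (ae_ball_iff countable_intLattice).2 fun c _ => ?_
    by_cases hc : c = 0
    · simp [hc]
    filter_upwards [measure_eq_zero_iff_ae_notMem.1
        (hausdorffMeasure_inner_fst_eq_zero (w := w) (hV.ne_zero v hv) hc),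
      measure_eq_zero_iff_ae_notMem.1
        (hausdorffMeasure_inner_snd_eq_zero (v := v) (hW.ne_zero w hw) hc)]
      with x hfst hsnd _ using ⟨hfst, hsnd⟩
  rw [boundaryMeasure, ae_restrict_iff'
    (isClosed_frontier.measurableSet.prod isClosed_frontier.measurableSet)]
  filter_upwards [ae_no_relation] with x hx hfrontier
  obtain ⟨-, w, hw, hwx⟩ := hW.mem_frontier_vertexPolar.1 hfrontier.1
  obtain ⟨-, v, hv, hvx⟩ := hV.mem_frontier_vertexPolar.1 hfrontier.2
  refine ⟨fun c hc h0 => ?_, fun c hc h0 => ?_⟩ <;> by_contra hne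
  · exact (hx w hw v hv c hc hne).1 ⟨hwx, h0, hvx⟩
  · exact (hx w hw v hv c hc hne).2 ⟨hvx, h0, hwx⟩

end Measure

end

end Billiard

theorem mainTheorem6 {n : ℕ} {H : Set (EuclideanSpace ℝ (Fin n))}
    (hH : Billiard.IsHannerPolytope n H) :
    ∀ᵐ x ∂(Billiard.boundaryMeasure H (Billiard.polarBody H)),
      Billiard.IsAdmissiblePosition H (Billiard.polarBody H) x.1 x.2 →
        ∃ (q p : ℕ → EuclideanSpace ℝ (Fin n)) (m : ℕ),
          Billiard.Generates H (Billiard.polarBody H) x.1 x.2 q p ∧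
          Billiard.IsClosedTrajectory m q p ∧
          Billiard.IsSimpleTrajectory m q ∧
          Billiard.closedLength (Billiard.polarBody H) m q = 4 := by
  obtain ⟨W, V, hWV, horbits, rfl⟩ := hH.exists_vertices
  rw [hWV.polarBody_vertexPolar]
  filter_upwards [Billiard.ae_boundaryMeasure_isGeneric hWV.left hWV.right] with x hx hadm
  obtain ⟨q, p, htrajectory⟩ := hWV.exists_generates horbits hx.1 hx.2 hadm
  exact ⟨q, p, 2 * n, htrajectory⟩
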